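/- Let $k$ be a field, let $q,\lambda_1,\lambda_2\in k$ be nonzero with $q^4\neq 1$, $\lambda_1\neq\lambda_2$ and $\lambda_1\neq q^2\lambda_2$, and let $n_1,n_2\ge 0$ be integers with $n=n_1+n_2\ge 1$. Let $H=H_k(n,2)$ be the unital $k$-algebra generated by $X,g_1,\dots,g_{n-1}$ subject to $$g_ig_{i+1}g_i=g_{i+1}g_ig_{i+1},\quad g_ig_j=g_jg_i\ (|i-j|\ge 2),\quad g_1Xg_1X=Xg_1Xg_1,\quad Xg_j=g_jX\ (j>1),$$ $$(g_i-q)(g_i+q^{-1})=0,\quad (X-\lambda_1)(X-\lambda_2)=0,$$ and put $X_1=X$, $X_{i+1}=g_iX_ig_i$. For a bipartition $(\tau,\mu)$ of $n$ with $a=|\tau|$ put $m_{(\tau,\mu)}=\prod_{i=1}^{a}(X_i-\lambda_2)\cdot\sum_w q^{\ell(w)}g_w$, where $w$ runs over the Young subgroup of $\mathfrak S_n$ whose blocks are consecutive intervals of lengths the rows of $\tau$ followed by the rows of $\mu$, and $g_w$ is the product of the $g_i$ along a reduced word of $w$. The Specht module (of Dipper, James and Murphy, in the form of a left module) is $$S(\tau,\mu)=Hm_{(\tau,\mu)}\big/\big(Hm_{(\tau,\mu)}\cap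 N\big),$$ where $N$ is the two-sided ideal of $H$ generated by all $m_{(\sigma,\rho)}$ with $(\sigma,\rho)$ strictly dominating $(\tau,\mu)$. Write $S(n_1,n_2)=S((n_1),(n_2))$. For $m\in\mathbb Z$ put $[m]=\frac{q^m-q^{-m}}{q-q^{-1}}$, and let the blob algebra $b_n=b_n(q,m)$ be the unital $k$-algebra generated by $U_0,\dots,U_{n-1}$ subject to $U_iU_jU_i=U_i$ ($i,j\ge 1$, $|i-j|=1$), $U_i^2=-[2]U_i$ ($i\ge 1$), $U_0^2=-[m]U_0$, $U_1U_0U_1=[m-1]U_1$, and $U_iU_j=U_jU_i$ ($|i-j|\ge2$). **Theorem.** 1. If $n\ge 2$, then $(X_1X_2-\lambda_1\lambda_2)(g_1-q)$ acts as zero on $S(n_1,n_2)$. 2. If moreover $\lambda_1=\frac{q^m}{q-q^{-1}}$ and $\lambda_2=\frac{q^{-m}}{q-q^{-1}}$ for an integer $m$ (here $n\ge1$ is arbitrary), then there is a surjective $k$-algebra homomorphism $\pi:H\to b_n(q,m)$ with $\pi(X-\lambda_1)=U_0$ and $\pi(g_i-q)=U_i$ for $1\le i\le n-1$, and the action of $H$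 on $S(n_1,n_2)$ factors through $\pi$: there is exactly one $k$-algebra homomorphism $\rho:b_n(q,m)\to\operatorname{End}_k(S(n_1,n_2))$ with $\rho(\pi(h))s=hs$ for all $h\in H$ and $s\in S(n_1,n_2)$. That is, $S(n_1,n_2)$ is a $b_n$-module, with $U_0$ acting as $X-\lambda_1$ and $U_i$ as $g_i-q$. -/

import Mathlib

/-! ### The cyclotomic Hecke algebra `H(n,2)` -/

namespace BlobSpecht

/-- Defining relations of the cyclotomic Hecke algebra with parameters `q, l₁, l₂`.
The generator of index `0` is `X`, the generator of index `i ≥ 1` is `g_i` (`1 ≤ i ≤ n - 1`). -/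
inductive HeckeRel {k : Type*} [Field k] (q l₁ l₂ : k) (n : ℕ) :
    FreeAlgebra k (Fin n) → FreeAlgebra k (Fin n) → Prop
  /-- `g_i g_{i+1} g_i = g_{i+1} g_i g_{i+1}` -/
  | braid (i j : Fin n) (hi : 1 ≤ i.val) (hj : j.val = i.val + 1) :
      HeckeRel q l₁ l₂ n
        (FreeAlgebra.ι k i * FreeAlgebra.ι k j * FreeAlgebra.ι k i)
        (FreeAlgebra.ι k j * FreeAlgebra.ι k i * FreeAlgebra.ι k j)
  /-- generators at distance at least `2` commute
  (for `i = 0` this says that `X` commutes with `g_j`, `j > 1`) -/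
  | comm (i j : Fin n) (hij : i.val + 1 < j.val) :
      HeckeRel q l₁ l₂ n
        (FreeAlgebra.ι k i * FreeAlgebra.ι k j)
        (FreeAlgebra.ι k j * FreeAlgebra.ι k i)
  /-- `g_1 X g_1 X = X g_1 X g_1` -/
  | braidX (i j : Fin n) (hi : i.val = 0) (hj : j.val = 1) :
      HeckeRel q l₁ l₂ n
        (FreeAlgebra.ι k j * FreeAlgebra.ι k i * FreeAlgebra.ι k j * FreeAlgebra.ι k i)
        (FreeAlgebra.ι k i * FreeAlgebra.ι k j * FreeAlgebra.ι k i * FreeAlgebra.ι k j)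
  /-- `(g_i - q) (g_i + q⁻¹) = 0` -/
  | quad (i : Fin n) (hi : 1 ≤ i.val) :
      HeckeRel q l₁ l₂ n
        ((FreeAlgebra.ι k i - algebraMap k _ q) * (FreeAlgebra.ι k i + algebraMap k _ q⁻¹)) 0
  /-- `(X - l₁) (X - l₂) = 0` -/
  | quadX (i : Fin n) (hi : i.val = 0) :
      HeckeRel q l₁ l₂ n
        ((FreeAlgebra.ι k i - algebraMap k _ l₁) * (FreeAlgebra.ι k i - algebraMap k _ l₂)) 0

/-- The algebra `H_k(n,2) = H_k(n, q, l₁, l₂)`. -/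
abbrev HeckeB {k : Type*} [Field k] (q l₁ l₂ : k) (n : ℕ) : Type _ :=
  RingQuot (HeckeRel q l₁ l₂ n)

namespace HeckeB

variable {k : Type*} [Field k] (q l₁ l₂ : k) (n : ℕ)

/-- `gen 0 = X` and `gen i = g_i` for `1 ≤ i ≤ n - 1`; the value for `i ≥ n` is irrelevant. -/
noncomputable def gen (i : ℕ) : HeckeB q l₁ l₂ n :=
  if h : i < n then RingQuot.mkAlgHom k _ (FreeAlgebra.ι k ⟨i, h⟩) else 0

/-- The elements `X_1 = X`, `X_{i+1} = g_i X_i g_i` (the index `0` is not used). -/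
noncomputable def jm : ℕ → HeckeB q l₁ l₂ n
  | 0 => 0
  | 1 => gen q l₁ l₂ n 0
  | i + 2 => gen q l₁ l₂ n (i + 1) * jm (i + 1) * gen q l₁ l₂ n (i + 1)

/-- The descending product `g_i g_{i-1} ⋯ g_{i-j+1}` (with `j` factors). -/
noncomputable def desc (i : ℕ) : ℕ → HeckeB q l₁ l₂ n
  | 0 => 1
  | j + 1 => desc i j * gen q l₁ l₂ n (i - j)

/-- The symmetrizer `∑_w q^{ℓ(w)} g_w`, where `w` runs over the symmetric group on
`{a + 1, …, a + m}`. Each `w` in the group for `m + 1` is, in exactly one way, a product with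
additive lengths of an element of the group for `m` and a coset representative
`σ_{a+m} σ_{a+m-1} ⋯ σ_{a+m-j+1}`, `0 ≤ j ≤ m`. -/
noncomputable def rowSymm (a : ℕ) : ℕ → HeckeB q l₁ l₂ n
  | 0 => 1
  | m + 1 => rowSymm a m * ∑ j ∈ Finset.range (m + 1), q ^ j • desc q l₁ l₂ n (a + m) j

/-- `∑_w q^{ℓ(w)} g_w` over the Young subgroup whose blocks are consecutive intervals, the first
one starting at `a + 1`, of the lengths in the list. -/
noncomputable def youngSymm : ℕ → List ℕ → HeckeB q l₁ l₂ n
  | _, [] => 1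
  | a, r :: rs => rowSymm q l₁ l₂ n a r * youngSymm (a + r) rs

/-- `(X_1 - l₂) (X_2 - l₂) ⋯ (X_a - l₂)` (the factors commute). -/
noncomputable def uPlus (a : ℕ) : HeckeB q l₁ l₂ n :=
  ((List.range a).map fun i => jm q l₁ l₂ n (i + 1) - algebraMap k _ l₂).prod

end HeckeB

/-! ### Bipartitions -/

/-- A bipartition `(τ, μ)` of `n`. -/
structure Bipartition (n : ℕ) where
  /-- size of `τ` -/
  size₁ : ℕ
  /-- size of `μ` -/
  size₂ : ℕ
  size_add : size₁ + size₂ = n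
  /-- `τ` -/
  fst : Nat.Partition size₁
  /-- `μ` -/
  snd : Nat.Partition size₂

namespace Bipartition

variable {n : ℕ}

/-- The row lengths of `τ`, in weakly decreasing order. -/
def rows₁ (b : Bipartition n) : List ℕ := b.fst.parts.sort (· ≥ ·)

/-- The row lengths of `μ`, in weakly decreasing order. -/
def rows₂ (b : Bipartition n) : List ℕ := b.snd.parts.sort (· ≥ ·)

/-- The dominance order `b ⊵ c` on bipartitions. -/
def Dominates (b c : Bipartition n) : Prop :=
  (∀ j : ℕ, (c.rows₁.take j).sum ≤ (b.rows₁.take j).sum) ∧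
    ∀ j : ℕ, c.size₁ + (c.rows₂.take j).sum ≤ b.size₁ + (b.rows₂.take j).sum

/-- Strict dominance `b ▷ c`. -/
def StrictlyDominates (b c : Bipartition n) : Prop :=
  b.Dominates c ∧ ¬ c.Dominates b

/-- The two-line bipartition `((n₁), (n₂))`. -/
def twoLine (n₁ n₂ : ℕ) : Bipartition (n₁ + n₂) where
  size₁ := n₁
  size₂ := n₂
  size_add := rfl
  fst := Nat.Partition.indiscrete n₁
  snd := Nat.Partition.indiscrete n₂

end Bipartition

/-! ### Specht modules -/

section Specht

variable {k : Type*} [Field k] (q l₁ l₂ : k) {n : ℕ}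

/-- The element `m_b = u_a⁺ x_b`, where `a = |τ|` for `b = (τ, μ)` and `x_b` is the symmetrizer
of the row stabilizer of the bitableau `t^b`. -/
noncomputable def murphyElt (b : Bipartition n) : HeckeB q l₁ l₂ n :=
  HeckeB.uPlus q l₁ l₂ n b.size₁ * HeckeB.youngSymm q l₁ l₂ n 0 (b.rows₁ ++ b.rows₂)

/-- The permutation module `M(b) = H m_b`. -/
noncomputable abbrev permModule (b : Bipartition n) :
    Submodule (HeckeB q l₁ l₂ n) (HeckeB q l₁ l₂ n) :=
  Submodule.span (HeckeB q l₁ l₂ n) {murphyElt q l₁ l₂ b}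

/-- The two-sided ideal of the cellular structure that belongs to the bipartitions strictly
dominating `b`: the one generated by all `m_c` with `c ▷ b`. -/
noncomputable def cellIdeal (b : Bipartition n) : TwoSidedIdeal (HeckeB q l₁ l₂ n) :=
  TwoSidedIdeal.span {x | ∃ c : Bipartition n, c.StrictlyDominates b ∧ x = murphyElt q l₁ l₂ c}

/-- The (Dipper–James–Murphy) Specht module `S(b) = M(b) / N(b)`, the cell module of `b`;
here `N(b)` is the intersection of `M(b)` with the ideal `cellIdeal b`. It is a left module over
`H_k(n,2)`, and in particular a `k`-vector space. -/
abbrev SpechtModule (b : Bipartition n) : Type _ :=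
  permModule q l₁ l₂ b ⧸
    (TwoSidedIdeal.asIdeal (cellIdeal q l₁ l₂ b)).submoduleOf (permModule q l₁ l₂ b)

end Specht

/-! ### The blob algebra -/

/-- The Gaussian integer `[m] = (q^m - q^{-m}) / (q - q⁻¹)`. -/
def gaussInt {k : Type*} [Field k] (q : k) (m : ℤ) : k :=
  (q ^ m - q ^ (-m)) / (q - q⁻¹)

/-- Defining relations of the blob algebra `b_n(q, m)` on the generators `U_0, …, U_{n-1}`. -/
inductive BlobRel {k : Type*} [Field k] (q : k) (m : ℤ) (n : ℕ) :
    FreeAlgebra k (Fin n) → FreeAlgebra k (Fin n) → Prop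
  /-- `U_i U_{i ± 1} U_i = U_i` for `i, i ± 1 ≥ 1` -/
  | tl (i j : Fin n) (hi : 1 ≤ i.val) (hj : 1 ≤ j.val)
      (hij : j.val = i.val + 1 ∨ i.val = j.val + 1) :
      BlobRel q m n
        (FreeAlgebra.ι k i * FreeAlgebra.ι k j * FreeAlgebra.ι k i) (FreeAlgebra.ι k i)
  /-- `U_i ^ 2 = -[2] U_i` for `i ≥ 1` -/
  | sq (i : Fin n) (hi : 1 ≤ i.val) :
      BlobRel q m n (FreeAlgebra.ι k i * FreeAlgebra.ι k i)
        (-(gaussInt q 2 • FreeAlgebra.ι k i))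
  /-- `U_0 ^ 2 = -[m] U_0` -/
  | sqZero (i : Fin n) (hi : i.val = 0) :
      BlobRel q m n (FreeAlgebra.ι k i * FreeAlgebra.ι k i)
        (-(gaussInt q m • FreeAlgebra.ι k i))
  /-- `U_1 U_0 U_1 = [m - 1] U_1` -/
  | blob (i j : Fin n) (hi : i.val = 0) (hj : j.val = 1) :
      BlobRel q m n (FreeAlgebra.ι k j * FreeAlgebra.ι k i * FreeAlgebra.ι k j)
        (gaussInt q (m - 1) • FreeAlgebra.ι k j)
  /-- `U_i U_j = U_j U_i` if `|i - j| ≥ 2` -/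
  | comm (i j : Fin n) (hij : i.val + 1 < j.val) :
      BlobRel q m n (FreeAlgebra.ι k i * FreeAlgebra.ι k j)
        (FreeAlgebra.ι k j * FreeAlgebra.ι k i)

/-- The blob algebra `b_n(q, m)`. -/
abbrev BlobAlgebra {k : Type*} [Field k] (q : k) (m : ℤ) (n : ℕ) : Type _ :=
  RingQuot (BlobRel q m n)

/-- The generator `U_i` of the blob algebra, `0 ≤ i ≤ n - 1`; the value for `i ≥ n` is
irrelevant. -/
noncomputable def BlobAlgebra.U {k : Type*} [Field k] (q : k) (m : ℤ) (n : ℕ) (i : ℕ) :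
    BlobAlgebra q m n :=
  if h : i < n then RingQuot.mkAlgHom k _ (FreeAlgebra.ι k ⟨i, h⟩) else 0

end BlobSpecht

namespace BlobSpecht

namespace HeckeB

section Relations

variable {k : Type*} [Field k] {q l₁ l₂ : k} {n : ℕ}

local notation "γ" => gen q l₁ l₂ n
local notation "J" => jm q l₁ l₂ n

theorem gen_of_lt {i : ℕ} (h : i < n) :
    γ i = RingQuot.mkAlgHom k (HeckeRel q l₁ l₂ n) (FreeAlgebra.ι k ⟨i, h⟩) := by
  simp [gen, h]

theorem gen_of_le {i : ℕ} (h : n ≤ i) : γ i = 0 := by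
  simp [gen, h]

theorem gen_braid {i : ℕ} (hi : 1 ≤ i) :
    γ i * γ (i + 1) * γ i = γ (i + 1) * γ i * γ (i + 1) := by
  by_cases h : i + 1 < n
  · rw [gen_of_lt h, gen_of_lt (i.lt_succ_self.trans h)]
    simpa using RingQuot.mkAlgHom_rel k
      (HeckeRel.braid (q := q) (l₁ := l₁) (l₂ := l₂) ⟨i, i.lt_succ_self.trans h⟩ ⟨i + 1, h⟩ hi rfl)
  · simp [gen_of_le (not_lt.mp h)]

theorem gen_comm {i j : ℕ} (h : i + 1 < j) : Commute (γ i) (γ j) := by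
  by_cases hj : j < n
  · have hi : i < n := by omega
    rw [gen_of_lt hi, gen_of_lt hj]
    simpa [Commute, SemiconjBy] using RingQuot.mkAlgHom_rel k
      (HeckeRel.comm (q := q) (l₁ := l₁) (l₂ := l₂) ⟨i, hi⟩ ⟨j, hj⟩ h)
  · simp [gen_of_le (not_lt.mp hj)]

theorem gen_braid_zero : γ 1 * γ 0 * γ 1 * γ 0 = γ 0 * γ 1 * γ 0 * γ 1 := by
  by_cases h : 1 < n
  · rw [gen_of_lt h, gen_of_lt (zero_lt_one.trans h)]
    simpa using RingQuot.mkAlgHom_rel k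
      (HeckeRel.braidX (q := q) (l₁ := l₁) (l₂ := l₂) ⟨0, zero_lt_one.trans h⟩ ⟨1, h⟩ rfl rfl)
  · simp [gen_of_le (not_lt.mp h)]

theorem gen_zero_quad (hn : 0 < n) :
    (γ 0 - algebraMap k _ l₁) * (γ 0 - algebraMap k _ l₂) = 0 := by
  rw [gen_of_lt hn]
  simpa using RingQuot.mkAlgHom_rel k
    (HeckeRel.quadX (q := q) (l₁ := l₁) (l₂ := l₂) ⟨0, hn⟩ rfl)

theorem gen_zero_mul_gen_zero (hn : 0 < n) :
    γ 0 * γ 0 = (l₁ + l₂) • γ 0 - (l₁ * l₂) • 1 := by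
  have h := gen_zero_quad (q := q) (l₁ := l₁) (l₂ := l₂) hn
  simp only [Algebra.algebraMap_eq_smul_one, mul_sub, sub_mul, smul_mul_assoc, mul_smul_comm,
    one_mul, mul_one] at h
  rw [← sub_eq_zero, ← h]
  module

theorem gen_mul_gen (hq : q ≠ 0) {i : ℕ} (hi : 1 ≤ i) (hn : i < n) :
    γ i * γ i = 1 + (q - q⁻¹) • γ i := by
  have h : (γ i - algebraMap k _ q) * (γ i + algebraMap k _ q⁻¹) = 0 := by
    rw [gen_of_lt hn]
    simpa using RingQuot.mkAlgHom_rel k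
      (HeckeRel.quad (q := q) (l₁ := l₁) (l₂ := l₂) ⟨i, hn⟩ hi)
  simp only [Algebra.algebraMap_eq_smul_one, mul_add, sub_mul, smul_mul_assoc, mul_smul_comm,
    one_mul, mul_one] at h
  rw [← sub_eq_zero, ← h]
  match_scalars <;> field_simp
  ring

/-! ### Jucys–Murphy elements -/

theorem jm_succ {i : ℕ} (hi : 1 ≤ i) : J (i + 1) = γ i * J i * γ i := by
  obtain ⟨i, rfl⟩ := Nat.exists_eq_add_of_le' hi
  rfl

theorem gen_comm_jm_of_lt {i j : ℕ} (h : j < i) : Commute (γ i) (J j) := by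
  induction j with
  | zero => exact Commute.zero_right _
  | succ j ih =>
    rcases Nat.eq_zero_or_pos j with rfl | hj
    · exact (gen_comm (by omega)).symm
    · rw [jm_succ hj]
      have h₁ : Commute (γ i) (γ j) := (gen_comm (by omega)).symm
      exact (h₁.mul_right (ih (by omega))).mul_right h₁

theorem gen_comm_jm_of_gt {i j : ℕ} (hi : 1 ≤ i) (h : i + 2 ≤ j) : Commute (γ i) (J j) := by
  induction j, h using Nat.le_induction with
  | base =>
    have h₁ := gen_braid (q := q) (l₁ := l₁) (l₂ := l₂) (n := n) hi
    have h₂ : γ (i + 1) * J i = J i * γ (i + 1) := gen_comm_jm_of_lt (by omega)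
    rw [jm_succ (by omega : 1 ≤ i + 1), jm_succ hi]
    change _ = _
    calc γ i * (γ (i + 1) * (γ i * J i * γ i) * γ (i + 1))
        = (γ i * γ (i + 1) * γ i) * J i * γ i * γ (i + 1) := by simp only [mul_assoc]
      _ = γ (i + 1) * γ i * (γ (i + 1) * J i) * γ i * γ (i + 1) := by
        rw [h₁]; simp only [mul_assoc]
      _ = γ (i + 1) * γ i * J i * (γ (i + 1) * γ i * γ (i + 1)) := by
        rw [h₂]; simp only [mul_assoc]
      _ = _ := by rw [← h₁]; simp only [mul_assoc]
  | succ j hj ih =>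
    rw [jm_succ (by omega)]
    have h₁ : Commute (γ i) (γ j) := gen_comm (by omega)
    exact (h₁.mul_right ih).mul_right h₁

theorem jm_comm_jm_succ {i : ℕ} (hi : 1 ≤ i) : Commute (J i) (J (i + 1)) := by
  induction i, hi using Nat.le_induction with
  | base =>
    have h := gen_braid_zero (q := q) (l₁ := l₁) (l₂ := l₂) (n := n)
    rw [jm_succ le_rfl]
    change γ 0 * (γ 1 * γ 0 * γ 1) = γ 1 * γ 0 * γ 1 * γ 0
    rw [h]
    simp only [mul_assoc]
  | succ i hi ih =>
    have h₁ := gen_braid (q := q) (l₁ := l₁) (l₂ := l₂) (n := n) hi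
    have h₂ : γ (i + 1) * J i = J i * γ (i + 1) := gen_comm_jm_of_lt (by omega)
    rw [jm_succ hi] at ih
    have h₃ : J i * γ i * J i * γ i = γ i * J i * γ i * J i := by
      simpa only [mul_assoc] using ih.eq
    rw [jm_succ (by omega : 1 ≤ i + 1), jm_succ hi]
    change _ = _
    calc γ i * J i * γ i * (γ (i + 1) * (γ i * J i * γ i) * γ (i + 1))
        = γ i * J i * (γ i * γ (i + 1) * γ i) * J i * γ i * γ (i + 1) := by
          simp only [mul_assoc]
      _ = γ i * (J i * γ (i + 1)) * γ i * (γ (i + 1) * J i) * γ i * γ (i + 1) := by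
        rw [h₁]; simp only [mul_assoc]
      _ = γ i * γ (i + 1) * J i * γ i * (γ (i + 1) * J i) * γ i * γ (i + 1) := by
        rw [← h₂]; simp only [mul_assoc]
      _ = γ i * γ (i + 1) * (J i * γ i * J i) * (γ (i + 1) * γ i * γ (i + 1)) := by
        rw [h₂]; simp only [mul_assoc]
      _ = γ i * γ (i + 1) * (J i * γ i * J i * γ i) * γ (i + 1) * γ i := by
        rw [← h₁]; simp only [mul_assoc]
      _ = (γ i * γ (i + 1) * γ i) * J i * γ i * (J i * γ (i + 1)) * γ i := by
        rw [h₃]; simp only [mul_assoc]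
      _ = γ (i + 1) * γ i * (γ (i + 1) * J i) * γ i * γ (i + 1) * J i * γ i := by
        rw [← h₂, h₁]; simp only [mul_assoc]
      _ = γ (i + 1) * γ i * J i * (γ (i + 1) * γ i * γ (i + 1)) * J i * γ i := by
        rw [h₂]; simp only [mul_assoc]
      _ = _ := by rw [← h₁]; simp only [mul_assoc]

theorem jm_comm_jm_of_lt {i j : ℕ} (hi : 1 ≤ i) (h : i < j) : Commute (J i) (J j) := by
  induction j, h using Nat.le_induction with
  | base => exact jm_comm_jm_succ hi
  | succ j hj ih =>
    rw [jm_succ (by omega)]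
    have h₁ : Commute (J i) (γ j) := (gen_comm_jm_of_lt (by omega)).symm
    exact (h₁.mul_right ih).mul_right h₁

theorem gen_comm_jm_mul_jm {i : ℕ} (hi : 1 ≤ i) : Commute (γ i) (J i * J (i + 1)) := by
  have h := (jm_comm_jm_succ (q := q) (l₁ := l₁) (l₂ := l₂) (n := n) hi).eq
  rw [jm_succ hi] at h ⊢
  change _ = _
  rw [h]
  simp only [mul_assoc] at h ⊢
  rw [h]

theorem gen_comm_jm_add_jm (hq : q ≠ 0) {i : ℕ} (hi : 1 ≤ i) (hn : i < n) :
    Commute (γ i) (J i + J (i + 1)) := by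
  have h := gen_mul_gen (l₁ := l₁) (l₂ := l₂) hq hi hn
  have h₁ : γ i * J (i + 1) = J i * γ i + (q - q⁻¹) • J (i + 1) := by
    rw [jm_succ hi, ← mul_assoc, ← mul_assoc, h]
    simp only [add_mul, one_mul, smul_mul_assoc]
  have h₂ : J (i + 1) * γ i = γ i * J i + (q - q⁻¹) • J (i + 1) := by
    rw [jm_succ hi, mul_assoc, h]
    simp only [mul_add, mul_one, mul_smul_comm]
  change _ = _
  rw [mul_add, add_mul, h₁, h₂]
  abel

theorem uPlus_succ (a : ℕ) :
    uPlus q l₁ l₂ n (a + 1) = uPlus q l₁ l₂ n a * (J (a + 1) - algebraMap k _ l₂) := by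
  simp [uPlus, List.range_succ]

theorem commute_uPlus {a : ℕ} {x : HeckeB q l₁ l₂ n}
    (h : ∀ i, 1 ≤ i → i ≤ a → Commute x (J i)) : Commute x (uPlus q l₁ l₂ n a) := by
  induction a with
  | zero => simp [uPlus]
  | succ a ih =>
    rw [uPlus_succ]
    exact (ih fun i h₁ h₂ => h i h₁ (by omega)).mul_right
      ((h _ (by omega) le_rfl).sub_right (Algebra.commutes _ _).symm)

theorem gen_comm_uPlus (hq : q ≠ 0) {i a : ℕ} (hi : 1 ≤ i) (hn : i < n) (ha : i ≠ a) :
    Commute (γ i) (uPlus q l₁ l₂ n a) := by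
  rcases lt_or_gt_of_ne ha with h | h
  · induction a, h using Nat.le_induction with
    | base =>
      obtain ⟨i, rfl⟩ := Nat.exists_eq_add_of_le' hi
      rw [uPlus_succ, uPlus_succ, mul_assoc]
      refine (commute_uPlus fun j _ h => gen_comm_jm_of_lt (by omega)).mul_right ?_
      have h : (J (i + 1) - algebraMap k _ l₂) * (J (i + 1 + 1) - algebraMap k _ l₂)
          = J (i + 1) * J (i + 1 + 1) - l₂ • (J (i + 1) + J (i + 1 + 1)) + (l₂ * l₂) • 1 := by
        simp only [Algebra.algebraMap_eq_smul_one, mul_sub, sub_mul, smul_mul_assoc,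
          mul_smul_comm, one_mul, mul_one]
        module
      rw [h]
      exact ((gen_comm_jm_mul_jm hi).sub_right
        ((gen_comm_jm_add_jm hq hi hn).smul_right _)).add_right ((Commute.one_right _).smul_right _)
    | succ a h ih =>
      rw [uPlus_succ]
      exact (ih (by omega)).mul_right
        ((gen_comm_jm_of_gt hi (by omega)).sub_right (Algebra.commutes _ _).symm)
  · exact commute_uPlus fun j _ hj => gen_comm_jm_of_lt (by omega)

theorem gen_zero_mul_uPlus {a : ℕ} (hn : 0 < n) (ha : 0 < a) :
    γ 0 * uPlus q l₁ l₂ n a = l₁ • uPlus q l₁ l₂ n a := by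
  have h : (γ 0 - algebraMap k _ l₁) * uPlus q l₁ l₂ n a = 0 := by
    obtain ⟨a, rfl⟩ := Nat.exists_eq_add_of_lt ha
    rw [uPlus, show 0 + a + 1 = a + 1 by omega, List.range_succ_eq_map, List.map_cons,
      List.prod_cons, ← mul_assoc]
    change (γ 0 - algebraMap k _ l₁) * (γ 0 - algebraMap k _ l₂) * _ = 0
    rw [gen_zero_quad hn, zero_mul]
  rwa [sub_mul, sub_eq_zero, ← Algebra.smul_def] at h

/-! ### Symmetrizers -/

/-- The ascending product `g_{t+1} g_{t+2} ⋯ g_{t+a}`. -/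
noncomputable def asc (q l₁ l₂ : k) (n t : ℕ) : ℕ → HeckeB q l₁ l₂ n
  | 0 => 1
  | a + 1 => asc q l₁ l₂ n t a * gen q l₁ l₂ n (t + a + 1)

/-- The sum of the `q^j g_{a+m-j+1} ⋯ g_{a+m}` over `0 ≤ j ≤ m`. -/
noncomputable def lsum (q l₁ l₂ : k) (n a : ℕ) : ℕ → HeckeB q l₁ l₂ n
  | 0 => 1
  | m + 1 => 1 + q • (lsum q l₁ l₂ n a m * gen q l₁ l₂ n (a + m + 1))

theorem asc_succ_left (t a : ℕ) :
    asc q l₁ l₂ n t (a + 1) = γ (t + 1) * asc q l₁ l₂ n (t + 1) a := by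
  induction a with
  | zero => simp [asc]
  | succ a ih => rw [asc, ih, asc, mul_assoc, show t + (a + 1) + 1 = t + 1 + a + 1 by omega]

theorem commute_asc {t a : ℕ} {x : HeckeB q l₁ l₂ n}
    (h : ∀ i, t < i → i ≤ t + a → Commute x (γ i)) : Commute x (asc q l₁ l₂ n t a) := by
  induction a with
  | zero => exact Commute.one_right _
  | succ a ih => exact (ih fun i h₁ h₂ => h i h₁ (by omega)).mul_right (h _ (by omega) (by omega))

theorem commute_lsum {a m : ℕ} {x : HeckeB q l₁ l₂ n}
    (h : ∀ i, a < i → i ≤ a + m → Commute x (γ i)) : Commute x (lsum q l₁ l₂ n a m) := by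
  induction m with
  | zero => exact Commute.one_right _
  | succ m ih =>
    exact (Commute.one_right _).add_right (((ih fun i h₁ h₂ => h i h₁ (by omega)).mul_right
      (h _ (by omega) (by omega))).smul_right _)

theorem asc_mul_gen {t a i : ℕ} (hi : t < i) (h : i < t + a) :
    asc q l₁ l₂ n t a * γ i = γ (i + 1) * asc q l₁ l₂ n t a := by
  induction a with
  | zero => omega
  | succ a ih =>
    rcases Nat.lt_or_ge i (t + a) with h' | h'
    · have h₁ : γ i * γ (t + a + 1) = γ (t + a + 1) * γ i := gen_comm (by omega)
      rw [asc, mul_assoc, ← h₁, ← mul_assoc, ih h', mul_assoc]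
    · obtain rfl : i = t + a := by omega
      obtain ⟨a, rfl⟩ := Nat.exists_eq_add_of_lt (show 0 < a by omega)
      rw [show 0 + a + 1 = a + 1 by omega] at *
      have h₁ : γ (t + a + 2) * asc q l₁ l₂ n t a = asc q l₁ l₂ n t a * γ (t + a + 2) :=
        commute_asc fun i _ _ => (gen_comm (by omega)).symm
      have h₂ := gen_braid (q := q) (l₁ := l₁) (l₂ := l₂) (n := n) (show 1 ≤ t + a + 1 by omega)
      simp only [asc, show t + (a + 1) = t + a + 1 by omega]
      calc asc q l₁ l₂ n t a * γ (t + a + 1) * γ (t + a + 1 + 1) * γ (t + a + 1)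
          = asc q l₁ l₂ n t a * (γ (t + a + 1) * γ (t + a + 1 + 1) * γ (t + a + 1)) := by
            simp only [mul_assoc]
        _ = (asc q l₁ l₂ n t a * γ (t + a + 2)) * γ (t + a + 1) * γ (t + a + 1 + 1) := by
          rw [h₂]; simp only [mul_assoc]
        _ = _ := by rw [← h₁]; simp only [mul_assoc]

theorem gen_mul_asc_mul_asc (t a : ℕ) :
    γ (t + 1) * (asc q l₁ l₂ n (t + 1) a * asc q l₁ l₂ n t a)
      = asc q l₁ l₂ n (t + 1) a * asc q l₁ l₂ n t a * γ (t + a + 1) := by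
  induction a with
  | zero => simp [asc]
  | succ a ih =>
    have h₁ : γ (t + a + 2) * asc q l₁ l₂ n t a = asc q l₁ l₂ n t a * γ (t + a + 2) :=
      commute_asc fun i _ _ => (gen_comm (by omega)).symm
    have h₂ : asc q l₁ l₂ n (t + 1) (a + 1) * asc q l₁ l₂ n t (a + 1)
        = asc q l₁ l₂ n (t + 1) a * asc q l₁ l₂ n t a * (γ (t + a + 2) * γ (t + a + 1)) := by
      rw [asc, asc, show t + 1 + a + 1 = t + a + 2 by omega, mul_assoc, ← mul_assoc (γ (t + a + 2)),
        h₁]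
      simp only [mul_assoc]
    have h₃ := gen_braid (q := q) (l₁ := l₁) (l₂ := l₂) (n := n) (show 1 ≤ t + a + 1 by omega)
    rw [h₂, ← mul_assoc, ih, mul_assoc, mul_assoc _ (_ * _), ← mul_assoc (γ (t + a + 1)), h₃]
    rfl

theorem desc_succ_left (i j : ℕ) :
    desc q l₁ l₂ n i (j + 1) = γ i * desc q l₁ l₂ n (i - 1) j := by
  induction j with
  | zero => simp [desc]
  | succ j ih =>
    rw [desc, ih, desc, mul_assoc, show i - (j + 1) = i - 1 - j by omega]

theorem sum_desc_succ (a m : ℕ) :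
    ∑ j ∈ Finset.range (m + 2), q ^ j • desc q l₁ l₂ n (a + (m + 1)) j
      = 1 + q • (γ (a + m + 1)
        * ∑ j ∈ Finset.range (m + 1), q ^ j • desc q l₁ l₂ n (a + m) j) := by
  rw [Finset.sum_range_succ', add_comm, Finset.mul_sum, Finset.smul_sum]
  congr 1
  · simp [desc]
  · refine Finset.sum_congr rfl fun j _ => ?_
    rw [desc_succ_left, mul_smul_comm, smul_smul, pow_succ']
    rfl

theorem mul_rowSymm {a s m : ℕ} {x : HeckeB q l₁ l₂ n}
    (h : ∀ i, a < i → i < a + m → x * γ i = γ (i + s) * x) :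
    x * rowSymm q l₁ l₂ n a m = rowSymm q l₁ l₂ n (a + s) m * x := by
  induction m with
  | zero => simp [rowSymm]
  | succ m ih =>
    have hd : ∀ j, j ≤ m →
        x * desc q l₁ l₂ n (a + m) j = desc q l₁ l₂ n (a + s + m) j * x := by
      intro j hj
      induction j with
      | zero => simp [desc]
      | succ j ihj =>
        rw [desc, ← mul_assoc, ihj (by omega), mul_assoc, h _ (by omega) (by omega), desc,
          mul_assoc, show a + m - j + s = a + s + m - j by omega]
    rw [rowSymm, ← mul_assoc, ih fun i h₁ h₂ => h i h₁ (by omega), mul_assoc, rowSymm, mul_assoc,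
      Finset.mul_sum, Finset.sum_mul]
    congr 1
    refine Finset.sum_congr rfl fun j hj => ?_
    rw [mul_smul_comm, smul_mul_assoc, hd j (by simpa [Nat.lt_succ_iff] using hj)]

theorem commute_rowSymm {a m : ℕ} {x : HeckeB q l₁ l₂ n}
    (h : ∀ i, a < i → i < a + m → Commute x (γ i)) : Commute x (rowSymm q l₁ l₂ n a m) :=
  mul_rowSymm (s := 0) h

theorem rowSymm_succ_left (a m : ℕ) :
    rowSymm q l₁ l₂ n a (m + 1) = lsum q l₁ l₂ n a m * rowSymm q l₁ l₂ n a m := by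
  induction m with
  | zero => simp [rowSymm, lsum, desc]
  | succ m ih =>
    have h : γ (a + m + 1) * rowSymm q l₁ l₂ n a m = rowSymm q l₁ l₂ n a m * γ (a + m + 1) :=
      commute_rowSymm fun i _ _ => (gen_comm (by omega)).symm
    rw [rowSymm, sum_desc_succ, lsum, mul_add, add_mul, mul_one, one_mul, mul_smul_comm,
      smul_mul_assoc]
    nth_rw 2 [ih]
    rw [mul_assoc (lsum q l₁ l₂ n a m), ← mul_assoc (rowSymm q l₁ l₂ n a m), ← h, mul_assoc (γ _),
      ← rowSymm, mul_assoc (lsum q l₁ l₂ n a m)]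

theorem gen_mul_rowSymm (hq : q ≠ 0) {a m i : ℕ} (hm : a + m ≤ n) (hi : a < i) (him : i < a + m) :
    γ i * rowSymm q l₁ l₂ n a m = q • rowSymm q l₁ l₂ n a m := by
  induction m generalizing i with
  | zero => omega
  | succ m ih =>
    rcases Nat.lt_or_ge i (a + m) with h | h
    · rw [rowSymm, ← mul_assoc, ih (by omega) hi h, smul_mul_assoc]
    obtain rfl : i = a + m := by omega
    obtain ⟨m, rfl⟩ := Nat.exists_eq_add_of_lt (show 0 < m by omega)
    rw [show 0 + m + 1 = m + 1 by omega] at *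
    have hG := gen_mul_gen (l₁ := l₁) (l₂ := l₂) (n := n) hq (show 1 ≤ a + (m + 1) by omega) (by omega)
    rw [rowSymm_succ_left]
    rcases m with _ | m
    · simp only [lsum, rowSymm, zero_add, Finset.sum_range_one, desc, pow_zero, one_smul, mul_one,
        add_zero, one_mul] at *
      rw [mul_add, mul_one, mul_smul_comm, hG]
      match_scalars <;> field_simp
      ring
    · have hF := ih (i := a + (m + 1)) (by omega) (by omega) (by omega)
      have hB := gen_braid (q := q) (l₁ := l₁) (l₂ := l₂) (n := n) (show 1 ≤ a + m + 1 by omega)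
      have hC : γ (a + (m + 2)) * lsum q l₁ l₂ n a m = lsum q l₁ l₂ n a m * γ (a + (m + 2)) :=
        commute_lsum fun i _ _ => (gen_comm (by omega)).symm
      simp only [lsum, ← add_assoc,
        show a + m + 1 + 1 = a + m + 2 by omega, show m + 1 + 1 = m + 2 by omega] at *
      set R := rowSymm q l₁ l₂ n a (m + 2)
      set L := lsum q l₁ l₂ n a m
      set F := γ (a + m + 1)
      set G := γ (a + m + 2)
      have h₁ : G * (L * F * G) * R = q • (L * F * G * R) := by
        calc G * (L * F * G) * R = (G * L) * F * G * R := by simp only [mul_assoc]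
          _ = L * (G * F * G) * R := by rw [hC]; simp only [mul_assoc]
          _ = L * F * G * (F * R) := by rw [← hB]; simp only [mul_assoc]
          _ = _ := by rw [hF, mul_smul_comm]
      have h₂ : G * ((1 + q • ((1 + q • (L * F)) * G)) * R)
          = G * R + q • (G * G * R) + (q * q) • (G * (L * F * G) * R) := by
        simp only [add_mul, mul_add, one_mul, smul_mul_assoc, mul_smul_comm, smul_add, smul_smul,
          mul_assoc]
        abel
      rw [h₂, h₁, hG]
      simp only [add_mul, one_mul, smul_mul_assoc, smul_add, smul_smul]
      match_scalars <;> field_simp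
      ring

theorem asc_mul_rowSymm (hq : q ≠ 0) {a b m : ℕ} (hm : a + b ≤ n) (h : m < b) :
    asc q l₁ l₂ n a m * rowSymm q l₁ l₂ n a b = q ^ m • rowSymm q l₁ l₂ n a b := by
  induction m with
  | zero => simp [asc]
  | succ m ih =>
    rw [asc, mul_assoc, gen_mul_rowSymm hq hm (by omega) (by omega), mul_smul_comm,
      ih (by omega), smul_smul, pow_succ']

/-- The symmetrizer of an interval is a right multiple of that of the interval without its
first element. -/
theorem exists_rowSymm_succ_eq (hq : q ≠ 0) {a m : ℕ} (hm : a + (m + 1) ≤ n) :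
    ∃ y, rowSymm q l₁ l₂ n a (m + 1) = rowSymm q l₁ l₂ n (a + 1) m * y := by
  have h : asc q l₁ l₂ n a m * rowSymm q l₁ l₂ n a m
      = rowSymm q l₁ l₂ n (a + 1) m * asc q l₁ l₂ n a m :=
    mul_rowSymm fun i => asc_mul_gen
  have h' := asc_mul_rowSymm (l₁ := l₁) (l₂ := l₂) hq hm m.lt_succ_self
  rw [rowSymm, ← mul_assoc, h, ← rowSymm] at h'
  refine ⟨(q ^ m)⁻¹ • (asc q l₁ l₂ n a m
    * ∑ j ∈ Finset.range (m + 1), q ^ j • desc q l₁ l₂ n (a + m) j), ?_⟩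
  rw [mul_smul_comm, ← mul_assoc, h', smul_smul, inv_mul_cancel₀ (pow_ne_zero _ hq), one_smul]

end Relations

section Modules

variable {k : Type*} [Field k] {q l₁ l₂ : k} {n : ℕ}

local notation "γ" => gen q l₁ l₂ n
local notation "J" => jm q l₁ l₂ n

variable {M : Type*} [AddCommGroup M] [Module k M] [Module (HeckeB q l₁ l₂ n) M]

/-- Stability of a subspace under the generators of index at least `t`. -/
def Stable (q l₁ l₂ : k) (n : ℕ) [Module (HeckeB q l₁ l₂ n) M] (t : ℕ) (Q : Submodule k M) : Prop :=
  ∀ i, t ≤ i → i < n → ∀ x ∈ Q, gen q l₁ l₂ n i • x ∈ Q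

/-- The smallest subspace that contains `v` and is stable under the generators of index at
least `t`. -/
def orb (q l₁ l₂ : k) (n : ℕ) [Module (HeckeB q l₁ l₂ n) M] (t : ℕ) (v : M) : Submodule k M :=
  sInf {Q | v ∈ Q ∧ Stable q l₁ l₂ n t Q}

local notation "𝒮" => Stable q l₁ l₂ n
local notation "𝒪" => orb q l₁ l₂ n

theorem mem_orb (t : ℕ) (v : M) : v ∈ 𝒪 t v := by
  simp only [orb, Submodule.mem_sInf]
  exact fun Q hQ => hQ.1

theorem stable_orb (t : ℕ) (v : M) : 𝒮 t (𝒪 t v) := by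
  intro i hi hn x hx
  simp only [orb, Submodule.mem_sInf] at hx ⊢
  exact fun Q hQ => hQ.2 i hi hn x (hx Q hQ)

theorem orb_le {t : ℕ} {v : M} {Q : Submodule k M} (hv : v ∈ Q) (hQ : 𝒮 t Q) :
    𝒪 t v ≤ Q :=
  sInf_le ⟨hv, hQ⟩

theorem Stable.mono {t s : ℕ} {Q : Submodule k M} (h : 𝒮 t Q) (hts : t ≤ s) : 𝒮 s Q :=
  fun i hi => h i (hts.trans hi)

theorem orb_anti {t s : ℕ} (h : t ≤ s) (v : M) : 𝒪 s v ≤ 𝒪 t v :=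
  orb_le (mem_orb t v) ((stable_orb t v).mono h)

theorem asc_smul_mem {s t a : ℕ} {Q : Submodule k M} (hQ : 𝒮 t Q) (hs : t ≤ s + 1)
    (ha : s + a < n) {v : M} (hv : v ∈ Q) : asc q l₁ l₂ n s a • v ∈ Q := by
  induction a generalizing v with
  | zero => simpa [asc] using hv
  | succ a ih =>
    rw [asc, mul_smul]
    exact ih (by omega) (hQ _ (by omega) (by omega) _ hv)

/-! ### Vectors of two-row type -/

/-- The generators of index above `t`, with the exception of the one of index `t + a`, act on `v`
by `q`. -/
def TwoRow (q l₁ l₂ : k) (n : ℕ) [Module (HeckeB q l₁ l₂ n) M] (t a : ℕ) (v : M) : Prop :=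
  ∀ i, t < i → i < n → i ≠ t + a → gen q l₁ l₂ n i • v = q • v

local notation "𝒯" => TwoRow q l₁ l₂ n
local notation "α" => asc q l₁ l₂ n

theorem TwoRow.succ {t a : ℕ} {v : M} (h : 𝒯 t (a + 1) v) : 𝒯 (t + 1) a v :=
  fun i hi hn ha => h i (by omega) hn (by omega)

variable [IsScalarTower k (HeckeB q l₁ l₂ n) M]

theorem mem_comap_lsmul {f : HeckeB q l₁ l₂ n} {Q : Submodule k M} {x : M} :
    x ∈ Q.comap (Algebra.lsmul k k M f) ↔ f • x ∈ Q :=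
  Iff.rfl

theorem stable_comap {t : ℕ} {f : HeckeB q l₁ l₂ n} {Q : Submodule k M}
    (hf : ∀ i, t ≤ i → i < n → Commute f (γ i)) (hQ : 𝒮 t Q) :
    𝒮 t (Q.comap (Algebra.lsmul k k M f)) := by
  intro i hi hn x hx
  rw [mem_comap_lsmul] at hx ⊢
  rw [smul_smul, hf i hi hn, mul_smul]
  exact hQ i hi hn _ hx

theorem smul_mem_of_mem_orb {t : ℕ} {f : HeckeB q l₁ l₂ n} {v : M} {Q : Submodule k M}
    (hf : ∀ i, t ≤ i → i < n → Commute f (γ i)) (hQ : 𝒮 t Q) (hv : f • v ∈ Q)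
    {x : M} (hx : x ∈ 𝒪 t v) : f • x ∈ Q :=
  orb_le (Q := Q.comap (Algebra.lsmul k k M f)) hv (stable_comap hf hQ) hx

theorem smul_eq_zero_of_mem_orb {t : ℕ} {f : HeckeB q l₁ l₂ n} {v : M}
    (hf : ∀ i, t ≤ i → i < n → Commute f (γ i)) (hv : f • v = 0)
    {x : M} (hx : x ∈ 𝒪 t v) : f • x = 0 := by
  rw [← Submodule.mem_bot k]
  refine smul_mem_of_mem_orb hf (fun i _ _ x hx => ?_) ((Submodule.mem_bot k).mpr hv) hx
  rw [Submodule.mem_bot] at hx ⊢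
  rw [hx, smul_zero]

theorem smul_eq_of_mem_orb {t : ℕ} {f : HeckeB q l₁ l₂ n} {c : k} {v : M}
    (hf : ∀ i, t ≤ i → i < n → Commute f (γ i)) (hv : f • v = c • v)
    {x : M} (hx : x ∈ 𝒪 t v) : f • x = c • x := by
  have h := smul_eq_zero_of_mem_orb (f := f - algebraMap k _ c)
    (fun i h₁ h₂ => (hf i h₁ h₂).sub_left (Algebra.commutes _ _)) ?_ hx
  · rwa [sub_smul, sub_eq_zero, algebraMap_smul] at h
  · rw [sub_smul, hv, algebraMap_smul, sub_self]

theorem gen_smul_gen_smul (hq : q ≠ 0) {i : ℕ} (hi : 1 ≤ i) (hn : i < n) (x : M) :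
    γ i • γ i • x = x + (q - q⁻¹) • γ i • x := by
  rw [smul_smul, gen_mul_gen hq hi hn, add_smul, one_smul, smul_assoc]

theorem TwoRow.asc_smul {t a : ℕ} {v : M} (h : 𝒯 t a v) : 𝒯 (t + 1) a (α t a • v) := by
  intro i hi hn ha
  obtain ⟨i, rfl⟩ := Nat.exists_eq_add_of_lt hi
  rw [smul_smul]
  rcases lt_or_gt_of_ne ha with h' | h'
  · rw [← asc_mul_gen (by omega) (by omega), mul_smul, h _ (by omega) (by omega) (by omega),
      smul_comm]
  · have h₁ : Commute (γ (t + 1 + i + 1)) (α t a) :=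
      commute_asc fun j _ _ => (gen_comm (by omega)).symm
    rw [h₁.eq, mul_smul, h _ (by omega) (by omega) (by omega), smul_comm]

theorem TwoRow.gen_smul_asc_smul_asc_smul {t a : ℕ} {v : M} (h : 𝒯 t a v)
    (hn : t + a + 1 < n) :
    γ (t + 1) • α (t + 1) a • α t a • v = q • α (t + 1) a • α t a • v := by
  rw [smul_smul, smul_smul, mul_assoc, gen_mul_asc_mul_asc, mul_smul, h _ (by omega) hn (by omega),
    smul_comm, mul_smul]

/-- The branching rule for two-row vectors. -/
theorem TwoRow.orb_le (hq : q ≠ 0) {t a : ℕ} {v : M} (hv : 𝒯 t a v) (ht : t < n)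
    (ha : t + a ≤ n) {Q : Submodule k M} (h₁ : 0 < a → 𝒪 (t + 2) v ≤ Q)
    (h₂ : t + a < n → 𝒪 (t + 2) (α t a • v) ≤ Q) : 𝒪 (t + 1) v ≤ Q := by
  obtain ⟨d, hd⟩ := Nat.exists_eq_add_of_lt ht
  induction d generalizing t a v Q with
  | zero =>
    refine HeckeB.orb_le ?_ fun i hi hn => by omega
    rcases Nat.eq_zero_or_pos a with rfl | h
    · simpa [asc] using h₂ (by omega) (mem_orb _ _)
    · exact h₁ h (mem_orb _ _)
  | succ d ih =>
    obtain ⟨Q₀, hQ₀⟩ : ∃ Q₀ : Submodule k M,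
        Q₀ = (⨆ _ : 0 < a, 𝒪 (t + 2) v) ⊔ ⨆ _ : t + a < n, 𝒪 (t + 2) (α t a • v) :=
      ⟨_, rfl⟩
    have hA : 0 < a → 𝒪 (t + 2) v ≤ Q₀ := fun h =>
      hQ₀ ▸ (le_iSup (fun _ : 0 < a => 𝒪 (t + 2) v) h).trans le_sup_left
    have hB : t + a < n → 𝒪 (t + 2) (α t a • v) ≤ Q₀ := fun h =>
      hQ₀ ▸ (le_iSup (fun _ : t + a < n => 𝒪 (t + 2) (α t a • v)) h).trans le_sup_right
    have hle : ∀ {Q' : Submodule k M}, (0 < a → 𝒪 (t + 2) v ≤ Q') →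
        (t + a < n → 𝒪 (t + 2) (α t a • v) ≤ Q') → Q₀ ≤ Q' :=
      fun h₁ h₂ => hQ₀ ▸ sup_le (iSup_le h₁) (iSup_le h₂)
    refine le_trans ?_ (hle h₁ h₂)
    clear hQ₀
    have hst : 𝒮 (t + 2) Q₀ := by
      intro i hi hn
      change Q₀ ≤ Q₀.comap (Algebra.lsmul k k M (γ i))
      exact hle (fun h x hx => hA h (stable_orb _ _ i hi hn x hx))
        (fun h x hx => hB h (stable_orb _ _ i hi hn x hx))
    have hst' : 𝒮 (t + 3) (Q₀.comap (Algebra.lsmul k k M (γ (t + 1)))) :=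
      stable_comap (fun i hi _ => gen_comm (by omega)) (hst.mono (by omega))
    have hquad : ∀ x : M, γ (t + 1) • γ (t + 1) • x = x + (q - q⁻¹) • γ (t + 1) • x :=
      gen_smul_gen_smul hq (by omega) (by omega)
    refine HeckeB.orb_le ?_ fun i hi hn => ?_
    · rcases Nat.eq_zero_or_pos a with rfl | h
      · have h := hB (by omega) (mem_orb _ _)
        rwa [asc, one_smul] at h
      · exact hA h (mem_orb _ _)
    rcases Nat.lt_or_ge (t + 1) i with hi' | hi'
    · exact hst i hi' hn
    obtain rfl : i = t + 1 := by omega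
    change Q₀ ≤ Q₀.comap (Algebra.lsmul k k M (γ (t + 1)))
    refine hle (fun h => ?_) (fun h => ?_)
    · obtain ⟨a, rfl⟩ := Nat.exists_eq_add_of_lt h
      rw [show 0 + a + 1 = a + 1 by omega] at *
      refine ih hv.succ (by omega) (by omega) (fun h' => ?_) (fun h' => ?_) (by omega)
      · refine HeckeB.orb_le ?_ hst'
        rw [mem_comap_lsmul, hv _ (by omega) hn (by omega)]
        exact Q₀.smul_mem _ (hA h (mem_orb _ _))
      · refine HeckeB.orb_le ?_ hst'
        rw [mem_comap_lsmul, ← mul_smul, ← asc_succ_left]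
        exact hB (by omega) (mem_orb _ _)
    · refine ih hv.asc_smul (by omega) (by omega) (fun h' => ?_) (fun h' => ?_) (by omega)
      · obtain ⟨a, rfl⟩ := Nat.exists_eq_add_of_lt h'
        rw [show 0 + a + 1 = a + 1 by omega] at *
        refine HeckeB.orb_le ?_ hst'
        rw [mem_comap_lsmul, asc_succ_left, mul_smul, hquad, ← mul_smul,
          ← asc_succ_left]
        refine Q₀.add_mem (hA h' ?_) (Q₀.smul_mem _ (hB h (mem_orb _ _)))
        exact asc_smul_mem (stable_orb _ _) le_rfl (by omega) (mem_orb _ _)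
      · refine HeckeB.orb_le ?_ hst'
        rw [mem_comap_lsmul,
          hv.gen_smul_asc_smul_asc_smul (by omega)]
        exact Q₀.smul_mem _ (hB h (asc_smul_mem (stable_orb _ _) le_rfl (by omega) (mem_orb _ _)))

end Modules

section TwoLine

variable {k : Type*} [Field k] {q l₁ l₂ : k} {n : ℕ}

local notation "γ" => gen q l₁ l₂ n
local notation "J" => jm q l₁ l₂ n
local notation "𝒪" => orb q l₁ l₂ n
local notation "𝒯" => TwoRow q l₁ l₂ n
local notation "α" => asc q l₁ l₂ n

variable {M : Type*} [AddCommGroup M] [Module k M] [Module (HeckeB q l₁ l₂ n) M]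
  [IsScalarTower k (HeckeB q l₁ l₂ n) M]

theorem jm_mul_gen (hq : q ≠ 0) {i : ℕ} (hi : 1 ≤ i) (hn : i < n) :
    J i * γ i = γ i * J (i + 1) - (q - q⁻¹) • J (i + 1) := by
  have h := gen_mul_gen (l₁ := l₁) (l₂ := l₂) hq hi hn
  rw [jm_succ hi, ← mul_assoc, ← mul_assoc, h]
  simp only [add_mul, one_mul, smul_mul_assoc, add_sub_cancel_right]

theorem jm_smul_asc_smul (hq : q ≠ 0) {t a : ℕ} {v : M} (hn : t + a + 1 < n)
    (hv : ∀ i, t < i → i < t + a + 1 → γ i • v = q • v)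
    (hJ : J (t + a + 2) • v = l₂ • v) :
    J (t + 1) • α t (a + 1) • v - l₂ • α t (a + 1) • v ∈ 𝒪 (t + 2) v := by
  induction a generalizing t with
  | zero =>
    have h : J (t + 1) • γ (t + 1) • v - l₂ • γ (t + 1) • v = -((q - q⁻¹) • l₂ • v) := by
      rw [smul_smul, jm_mul_gen hq (by omega) (by omega), sub_smul, mul_smul, smul_assoc]
      erw [hJ]
      rw [smul_comm (γ (t + 1))]
      abel
    rw [asc_succ_left, asc, mul_one, h]
    exact neg_mem (Submodule.smul_mem _ _ (Submodule.smul_mem _ _ (mem_orb _ _)))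
  | succ a ih =>
    have hy := ih (t := t + 1) (by omega) (fun i h₁ h₂ => hv i (by omega) (by omega))
      (by rwa [show t + 1 + a + 2 = t + (a + 1) + 2 by omega])
    have hw : α (t + 1) (a + 1) • v ∈ 𝒪 (t + 2) v :=
      asc_smul_mem (stable_orb _ _) le_rfl (by omega) (mem_orb _ _)
    rw [asc_succ_left, mul_smul]
    set w := α (t + 1) (a + 1) • v
    set y := J (t + 1 + 1) • w - l₂ • w with hy'
    have hγ : γ (t + 1) • y = q • y :=
      smul_eq_of_mem_orb (fun i hi _ => gen_comm (by omega)) (hv _ (by omega) (by omega)) hy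
    have h : J (t + 1) • γ (t + 1) • w - l₂ • γ (t + 1) • w
        = γ (t + 1) • y - (q - q⁻¹) • l₂ • w - (q - q⁻¹) • y := by
      rw [smul_smul, jm_mul_gen hq (by omega) (by omega), sub_smul, mul_smul, smul_assoc, hy',
        smul_sub, smul_sub, smul_comm (γ (t + 1)) l₂]
      abel
    rw [h, hγ]
    have hy₂ := orb_anti (show t + 2 ≤ t + 1 + 2 by omega) v hy
    exact sub_mem (sub_mem (Submodule.smul_mem _ _ hy₂)
      (Submodule.smul_mem _ _ (Submodule.smul_mem _ _ hw))) (Submodule.smul_mem _ _ hy₂)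

/-- The relations satisfied by the generator of the Specht module of the two-line bipartition
`((a), (n - a))`. -/
structure IsTwoLine (q l₁ l₂ : k) (n : ℕ) [Module (HeckeB q l₁ l₂ n) M] (a : ℕ) (v : M) :
    Prop where
  twoRow : TwoRow q l₁ l₂ n 0 a v
  gen_zero : 0 < a → gen q l₁ l₂ n 0 • v = l₁ • v
  jm : a < n → jm q l₁ l₂ n (a + 1) • v = l₂ • v

theorem IsTwoLine.gen_zero_smul_mem (hq : q ≠ 0) {a : ℕ} {v : M}
    (hv : IsTwoLine q l₁ l₂ n a v) (hn : 0 < n) (ha : a ≤ n) {x : M} (hx : x ∈ 𝒪 1 v) :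
    γ 0 • x ∈ 𝒪 1 v := by
  have hc : ∀ i, 2 ≤ i → i < n → Commute (γ 0) (γ i) := fun i hi _ => gen_comm (by omega)
  have hs := (stable_orb (q := q) (l₁ := l₁) (l₂ := l₂) (n := n) 1 v).mono (one_le_two)
  refine hv.twoRow.orb_le (Q := (𝒪 1 v).comap (Algebra.lsmul k k M (γ 0))) hq hn (by omega)
    (fun h x hx => ?_) (fun h x hx => ?_) hx
  · refine smul_mem_of_mem_orb hc hs ?_ hx
    rw [hv.gen_zero h]
    exact Submodule.smul_mem _ _ (mem_orb _ _)
  · refine smul_mem_of_mem_orb hc hs ?_ hx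
    rw [zero_add] at h
    rcases a with _ | a
    · rw [asc, one_smul]
      erw [hv.jm h]
      exact Submodule.smul_mem _ _ (mem_orb _ _)
    · have hy := jm_smul_asc_smul (t := 0) (a := a) hq (by omega)
        (fun i h₁ h₂ => hv.twoRow i h₁ (by omega) (by omega))
        (by simpa only [zero_add] using hv.jm h)
      rw [← sub_add_cancel (γ 0 • _)]
      exact add_mem (orb_anti one_le_two _ hy) (Submodule.smul_mem _ _
        (asc_smul_mem (stable_orb 1 v) le_rfl (by omega) (mem_orb 1 v)))

/-- A subspace that is stable under the generators is stable under the algebra. -/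
theorem smul_mem_of_stable_zero {Q : Submodule k M} (hQ : Stable q l₁ l₂ n 0 Q)
    (h : HeckeB q l₁ l₂ n) {x : M} (hx : x ∈ Q) : h • x ∈ Q := by
  obtain ⟨p, rfl⟩ := RingQuot.mkAlgHom_surjective k (HeckeRel q l₁ l₂ n) h
  induction p using FreeAlgebra.induction generalizing x with
  | grade0 r =>
    rw [AlgHom.commutes, algebraMap_smul]
    exact Q.smul_mem _ hx
  | grade1 i =>
    rw [← gen_of_lt i.2]
    exact hQ _ (by omega) i.2 _ hx
  | mul a b ha hb =>
    rw [map_mul, mul_smul]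
    exact ha (hb hx)
  | add a b ha hb =>
    rw [map_add, add_smul]
    exact Q.add_mem (ha hx) (hb hx)

theorem IsTwoLine.smul_mem_orb (hq : q ≠ 0) {a : ℕ} {v : M}
    (hv : IsTwoLine q l₁ l₂ n a v) (hn : 0 < n) (ha : a ≤ n) (h : HeckeB q l₁ l₂ n) :
    h • v ∈ 𝒪 1 v := by
  refine smul_mem_of_stable_zero (fun i _ hi x hx => ?_) h (mem_orb 1 v)
  rcases Nat.eq_zero_or_pos i with rfl | h
  · exact hv.gen_zero_smul_mem hq hn ha hx
  · exact stable_orb _ _ i h hi x hx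

theorem smul_eq_zero_of_mul_gen (hq : q ≠ 0) (hq4 : q ^ 4 ≠ 1) {f : HeckeB q l₁ l₂ n} {i : ℕ}
    (hf : f * γ i = (-q⁻¹) • f) {x : M} (hx : γ i • x = q • x) : f • x = 0 := by
  have h : (q + q⁻¹) • f • x = 0 := by
    rw [add_smul, smul_comm q f x, ← hx, smul_smul, hf, smul_assoc, neg_smul, neg_add_cancel]
  refine (smul_eq_zero.mp h).resolve_left fun h => hq4 ?_
  field_simp at h
  linear_combination (q ^ 2 - 1) * h

theorem TwoRow.smul_eq_zero_of_mem_orb (hq : q ≠ 0) (hq4 : q ^ 4 ≠ 1) {a : ℕ} {v : M}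
    (hv : 𝒯 0 a v) (hn : 2 ≤ n) (ha : a ≤ n) {f : HeckeB q l₁ l₂ n}
    (hf : f * γ 1 = (-q⁻¹) • f)
    (h : ∀ b, a = b + 1 → a < n → ∀ x ∈ 𝒪 3 (α 1 b • v), f • x = 0)
    {x : M} (hx : x ∈ 𝒪 1 v) : f • x = 0 := by
  have hc : ∀ i, 3 ≤ i → i < n → Commute (γ 1) (γ i) := fun i hi _ => gen_comm (by omega)
  have hle : 𝒪 1 v ≤ LinearMap.ker (Algebra.lsmul k k M f) := by
    refine hv.orb_le hq (by omega) (by omega) (fun h₀ => ?_) (fun h₀ => ?_)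
    · obtain ⟨b, rfl⟩ : ∃ b, a = b + 1 := ⟨a - 1, by omega⟩
      refine hv.succ.orb_le hq (by omega) (by omega) (fun h₁ x hx => ?_) (fun h₁ x hx => ?_)
      · exact smul_eq_zero_of_mul_gen hq hq4 hf
          (smul_eq_of_mem_orb hc (hv 1 (by omega) (by omega) (by omega)) hx)
      · exact h b rfl (by omega) x hx
    · refine hv.asc_smul.orb_le hq (by omega) (by omega) (fun h₁ => ?_) (fun h₁ x hx => ?_)
      · obtain ⟨b, rfl⟩ : ∃ b, a = b + 1 := ⟨a - 1, by omega⟩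
        have h₂ : 𝒪 3 (α 0 (b + 1) • v)
            ≤ (𝒪 3 (α 1 b • v)).map (Algebra.lsmul k k M (γ 1)) := by
          refine HeckeB.orb_le ⟨_, mem_orb _ _, ?_⟩ ?_
          · rw [asc_succ_left, mul_smul]
            rfl
          · rintro i hi hn _ ⟨y, hy, rfl⟩
            refine ⟨_, stable_orb _ _ i hi hn y hy, ?_⟩
            change γ 1 • γ i • y = γ i • γ 1 • y
            rw [smul_smul, hc i hi hn, mul_smul]
        refine h₂.trans ?_
        rintro _ ⟨y, hy, rfl⟩
        change f • γ 1 • y = 0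
        rw [smul_smul, hf, smul_assoc, h b rfl (by omega) y hy, smul_zero]
      · exact smul_eq_zero_of_mul_gen hq hq4 hf
          (smul_eq_of_mem_orb hc (hv.gen_smul_asc_smul_asc_smul (by omega)) hx)
  exact hle hx

theorem gen_sub_mul_gen (hq : q ≠ 0) {i : ℕ} (hi : 1 ≤ i) (hn : i < n) :
    (γ i - algebraMap k _ q) * γ i = (-q⁻¹) • (γ i - algebraMap k _ q) := by
  rw [sub_mul, gen_mul_gen hq hi hn]
  simp only [Algebra.algebraMap_eq_smul_one, smul_mul_assoc, one_mul]
  match_scalars <;> field_simp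
  ring

/-- The element `(X_1 X_2 - l₁ l₂) (g_1 - q)` annihilates the two-line Specht module. -/
theorem IsTwoLine.jm_mul_jm_sub_smul (hq : q ≠ 0) (hq4 : q ^ 4 ≠ 1) {a : ℕ} {v : M}
    (hv : IsTwoLine q l₁ l₂ n a v) (hn : 2 ≤ n) (ha : a ≤ n) {x : M} (hx : x ∈ 𝒪 1 v) :
    ((J 1 * J 2 - algebraMap k _ (l₁ * l₂)) * (γ 1 - algebraMap k _ q)) • x = 0 := by
  refine hv.twoRow.smul_eq_zero_of_mem_orb hq hq4 hn ha ?_ (fun b hb hbn x hx => ?_) hx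
  · rw [mul_assoc, gen_sub_mul_gen hq le_rfl (by omega), mul_smul_comm]
  have hE : Commute (J 1 * J 2 - algebraMap k _ (l₁ * l₂)) (γ 1 - algebraMap k _ q) :=
    ((gen_comm_jm_mul_jm le_rfl).symm.sub_left (Algebra.commutes _ _)).sub_right
      (Algebra.commutes _ _).symm
  refine HeckeB.smul_eq_zero_of_mem_orb (fun i hi _ => ?_) ?_ hx
  · refine Commute.mul_left (Commute.sub_left ?_ (Algebra.commutes _ _))
      ((gen_comm (by omega)).sub_left (Algebra.commutes _ _))
    exact (gen_comm_jm_of_lt (by omega)).symm.mul_left (gen_comm_jm_of_lt (by omega)).symm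
  have h₁ : J 1 • α 1 b • v = l₁ • α 1 b • v := by
    have h : Commute (γ 0) (α 1 b) := commute_asc fun i _ _ => gen_comm (by omega)
    change γ 0 • α 1 b • v = _
    rw [smul_smul, h.eq, mul_smul, hv.gen_zero (by omega), smul_comm]
  have h₂ : (J 1 * J 2 - algebraMap k _ (l₁ * l₂)) • α 1 b • v
      = l₁ • (J 2 • α 1 b • v - l₂ • α 1 b • v) := by
    rw [(jm_comm_jm_succ le_rfl : J 1 * J 2 = _), sub_smul, mul_smul, h₁, algebraMap_smul,
      smul_sub, mul_smul l₁ l₂, smul_comm]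
  rw [hE.eq, mul_smul, h₂, smul_comm]
  subst hb
  rcases b with _ | b
  · have h := hv.jm hbn
    simp only [zero_add] at h
    rw [asc, one_smul, h, sub_self, smul_zero, smul_zero]
  · have hy := jm_smul_asc_smul (t := 1) (a := b) hq (by omega)
      (fun i h₁ h₂ => hv.twoRow i (by omega) (by omega) (by omega))
      (by rw [show 1 + b + 2 = b + 1 + 1 + 1 by omega]; exact hv.jm hbn)
    have h₃ : γ 1 • (J 2 • α 1 (b + 1) • v - l₂ • α 1 (b + 1) • v)
        = q • (J 2 • α 1 (b + 1) • v - l₂ • α 1 (b + 1) • v) :=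
      smul_eq_of_mem_orb (fun i hi _ => gen_comm (by omega))
        (hv.twoRow 1 (by omega) (by omega) (by omega)) hy
    rw [sub_smul, h₃, algebraMap_smul, sub_self, smul_zero]

/-- The Temperley–Lieb element `U_i U_j U_i - U_i`, where `U_i = g_i - q`. -/
noncomputable def tl (q l₁ l₂ : k) (n i j : ℕ) : HeckeB q l₁ l₂ n :=
  (gen q l₁ l₂ n i - algebraMap k _ q) * (gen q l₁ l₂ n j - algebraMap k _ q) *
    (gen q l₁ l₂ n i - algebraMap k _ q) - (gen q l₁ l₂ n i - algebraMap k _ q)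

theorem tl_mul_gen (hq : q ≠ 0) {i j : ℕ} (hi : 1 ≤ i) (hn : i < n) :
    tl q l₁ l₂ n i j * γ i = (-q⁻¹) • tl q l₁ l₂ n i j := by
  rw [tl, sub_mul, mul_assoc, gen_sub_mul_gen hq hi hn, mul_smul_comm]
  exact (smul_sub (-q⁻¹) (_ : HeckeB q l₁ l₂ n) _).symm

theorem tl_comm (hq : q ≠ 0) {i : ℕ} (hi : 1 ≤ i) (hn : i + 1 < n) :
    tl q l₁ l₂ n i (i + 1) = tl q l₁ l₂ n (i + 1) i := by
  have h := gen_braid (q := q) (l₁ := l₁) (l₂ := l₂) (n := n) hi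
  have h₁ := gen_mul_gen (l₁ := l₁) (l₂ := l₂) (n := n) hq hi (by omega)
  have h₂ := gen_mul_gen (l₁ := l₁) (l₂ := l₂) hq (by omega : 1 ≤ i + 1) hn
  simp only [tl, Algebra.algebraMap_eq_smul_one, mul_sub, sub_mul, smul_mul_assoc, mul_smul_comm,
    one_mul, mul_one, smul_sub, h₁, h₂, h]
  match_scalars <;> field_simp <;> ring

theorem TwoRow.tl_smul (hq : q ≠ 0) (hq4 : q ^ 4 ≠ 1) {a : ℕ} {v : M}
    (hv : 𝒯 0 a v) (hn : 3 ≤ n) (ha : a ≤ n) {x : M} (hx : x ∈ 𝒪 1 v) :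
    tl q l₁ l₂ n 1 2 • x = 0 := by
  have hT₁ := tl_mul_gen (l₁ := l₁) (l₂ := l₂) (j := 2) hq le_rfl (by omega : 1 < n)
  have hT₂ : tl q l₁ l₂ n 1 2 * γ 2 = (-q⁻¹) • tl q l₁ l₂ n 1 2 := by
    rw [tl_comm hq le_rfl (by omega)]
    exact tl_mul_gen hq (by omega) (by omega)
  refine hv.smul_eq_zero_of_mem_orb hq hq4 (by omega) ha hT₁ (fun b hb hbn x hx => ?_) hx
  subst hb
  have hle : 𝒪 3 (α 1 b • v) ≤ LinearMap.ker (Algebra.lsmul k k M (tl q l₁ l₂ n 1 2)) := by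
    refine hv.succ.asc_smul.orb_le hq (by omega) (by omega) (fun h x hx => ?_) (fun h x hx => ?_)
    · refine HeckeB.smul_eq_zero_of_mem_orb (fun i hi _ => ?_) ?_ hx
      · have h₁ : Commute (γ 1 - algebraMap k _ q) (γ i) :=
          (gen_comm (by omega)).sub_left (Algebra.commutes _ _)
        have h₂ : Commute (γ 2 - algebraMap k _ q) (γ i) :=
          (gen_comm (by omega)).sub_left (Algebra.commutes _ _)
        exact ((h₁.mul_left h₂).mul_left h₁).sub_left h₁
      · have h₁ : tl q l₁ l₂ n 1 2 • γ 1 • α 1 b • v = 0 := by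
          rw [← mul_smul (γ 1), ← asc_succ_left]
          exact smul_eq_zero_of_mul_gen hq hq4 hT₂
            (hv.asc_smul 2 (by omega) (by omega) (by omega))
        rw [smul_smul, hT₁, smul_assoc] at h₁
        exact (smul_eq_zero.mp h₁).resolve_left (neg_ne_zero.mpr (inv_ne_zero hq))
    · exact smul_eq_zero_of_mul_gen hq hq4 hT₂
        (smul_eq_of_mem_orb (fun i hi _ => gen_comm (by omega))
          (hv.succ.gen_smul_asc_smul_asc_smul (by omega)) hx)
  exact hle hx

theorem exists_gen_smul_eq (hq : q ≠ 0) {i : ℕ} (hi : 1 ≤ i) (hn : i < n) (x : M) :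
    ∃ y : M, γ i • y = x := by
  refine ⟨γ i • x - (q - q⁻¹) • x, ?_⟩
  rw [smul_sub, gen_smul_gen_smul hq hi hn, smul_comm (γ i), add_sub_cancel_right]

theorem tl_smul_eq_zero (hq : q ≠ 0) (h : 3 ≤ n → ∀ x : M, tl q l₁ l₂ n 1 2 • x = 0) {i : ℕ}
    (hi : 1 ≤ i) (hn : i + 1 < n) (x : M) : tl q l₁ l₂ n i (i + 1) • x = 0 := by
  induction i, hi using Nat.le_induction generalizing x with
  | base => exact h hn x
  | succ i hi ih =>
    obtain ⟨i, rfl⟩ := Nat.exists_eq_add_of_le' hi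
    obtain ⟨x, rfl⟩ := exists_gen_smul_eq (l₁ := l₁) (l₂ := l₂) (n := n) hq hi (by omega) x
    obtain ⟨x, rfl⟩ := exists_gen_smul_eq (l₁ := l₁) (l₂ := l₂) (n := n) hq
      (by omega : 1 ≤ i + 1 + 1) (by omega) x
    obtain ⟨x, rfl⟩ := exists_gen_smul_eq (l₁ := l₁) (l₂ := l₂) (n := n) hq
      (by omega : 1 ≤ i + 1 + 1 + 1) (by omega) x
    have h₁ : α i 3 * (γ (i + 1) - algebraMap k _ q)
        = (γ (i + 1 + 1) - algebraMap k _ q) * α i 3 := by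
      rw [mul_sub, sub_mul, asc_mul_gen (by omega) (by omega), Algebra.commutes]
    have h₂ : α i 3 * (γ (i + 1 + 1) - algebraMap k _ q)
        = (γ (i + 1 + 1 + 1) - algebraMap k _ q) * α i 3 := by
      rw [mul_sub, sub_mul, asc_mul_gen (by omega) (by omega), Algebra.commutes]
    have h₃ : tl q l₁ l₂ n (i + 1 + 1) (i + 1 + 1 + 1) * α i 3
        = α i 3 * tl q l₁ l₂ n (i + 1) (i + 1 + 1) :=
      (((SemiconjBy.mul_right h₁ h₂).mul_right h₁).sub_right h₁).symm
    have h₄ : γ (i + 1) • γ (i + 1 + 1) • γ (i + 1 + 1 + 1) • x = α i 3 • x := by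
      simp only [asc, one_mul, mul_smul, add_zero]
    rw [h₄, smul_smul, h₃, mul_smul, ih (by omega), smul_zero]

end TwoLine

end HeckeB

/-! ### The generator of the two-line Specht module -/

namespace Bipartition

theorem sort_parts_indiscrete (m : ℕ) :
    (Nat.Partition.indiscrete m).parts.sort (· ≥ ·) = if m = 0 then [] else [m] := by
  rcases eq_or_ne m 0 with rfl | h
  · simp [Nat.Partition.indiscrete, Nat.Partition.ofSums, Multiset.filter_singleton]
  · rw [Nat.Partition.indiscrete_parts h, if_neg h, Multiset.sort_singleton]

/-- The bipartition `((n₁, 1), (n₂))`. -/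
def twoLineSucc (n₁ n₂ : ℕ) : Bipartition (n₁ + (n₂ + 1)) where
  size₁ := n₁ + 1
  size₂ := n₂
  size_add := by omega
  fst := Nat.Partition.ofSums (n₁ + 1) (n₁ ::ₘ {1}) (by simp)
  snd := Nat.Partition.indiscrete n₂

theorem rows₁_twoLineSucc (n₁ n₂ : ℕ) :
    (twoLineSucc n₁ n₂).rows₁ = if n₁ = 0 then [1] else [n₁, 1] := by
  rcases eq_or_ne n₁ 0 with rfl | h
  · simp [rows₁, twoLineSucc, Nat.Partition.ofSums, Multiset.filter_singleton]
  · have h' : (twoLineSucc n₁ n₂).fst.parts = n₁ ::ₘ {1} := by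
      simp [twoLineSucc, Nat.Partition.ofSums, Multiset.filter_singleton, h]
    rw [rows₁, h', if_neg h, Multiset.sort_cons, Multiset.sort_singleton]
    simpa using Nat.one_le_iff_ne_zero.mpr h

theorem twoLineSucc_strictlyDominates (n₁ n₂ : ℕ) :
    (twoLineSucc n₁ n₂).StrictlyDominates (twoLine n₁ (n₂ + 1)) := by
  have h₁ : (twoLine n₁ (n₂ + 1)).rows₁ = if n₁ = 0 then [] else [n₁] := sort_parts_indiscrete _
  have h₂ : (twoLine n₁ (n₂ + 1)).rows₂ = [n₂ + 1] := sort_parts_indiscrete _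
  have h₃ : (twoLineSucc n₁ n₂).rows₂ = if n₂ = 0 then [] else [n₂] := sort_parts_indiscrete _
  have hs : (twoLineSucc n₁ n₂).size₁ = n₁ + 1 := rfl
  have hs' : (twoLine n₁ (n₂ + 1)).size₁ = n₁ := rfl
  refine ⟨⟨fun j => ?_, fun j => ?_⟩, fun h => ?_⟩
  · rw [h₁, rows₁_twoLineSucc]
    rcases j with _ | j
    · simp
    · split_ifs <;> simp
  · rw [h₂, h₃, hs, hs']
    rcases j with _ | j
    · simp
    · split_ifs with h
      · simp [h]
      · simp only [List.take_succ_cons, List.take_nil, List.sum_cons, List.sum_nil]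
        omega
  · have := h.2 0
    simp only [List.take_zero, List.sum_nil, hs, hs'] at this
    omega

end Bipartition

open HeckeB Bipartition

section SpechtGen

variable {k : Type*} [Field k] {q l₁ l₂ : k} {n : ℕ}

theorem youngSymm_sort_append (a m : ℕ) (l : List ℕ) :
    youngSymm q l₁ l₂ n a ((Nat.Partition.indiscrete m).parts.sort (· ≥ ·) ++ l)
      = rowSymm q l₁ l₂ n a m * youngSymm q l₁ l₂ n (a + m) l := by
  rw [sort_parts_indiscrete]
  split_ifs with h
  · subst h
    simp [rowSymm]
  · simp [youngSymm]

theorem youngSymm_sort (a m : ℕ) :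
    youngSymm q l₁ l₂ n a ((Nat.Partition.indiscrete m).parts.sort (· ≥ ·))
      = rowSymm q l₁ l₂ n a m := by
  simpa [youngSymm] using youngSymm_sort_append (q := q) (l₁ := l₁) (l₂ := l₂) (n := n) a m []

theorem murphyElt_twoLine (n₁ n₂ : ℕ) :
    murphyElt q l₁ l₂ (twoLine n₁ n₂) = uPlus q l₁ l₂ (n₁ + n₂) n₁ *
      (rowSymm q l₁ l₂ (n₁ + n₂) 0 n₁ * rowSymm q l₁ l₂ (n₁ + n₂) n₁ n₂) := by
  rw [murphyElt, rows₁, rows₂]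
  simp only [twoLine]
  rw [youngSymm_sort_append, youngSymm_sort, zero_add]

theorem murphyElt_twoLineSucc (n₁ n₂ : ℕ) :
    murphyElt q l₁ l₂ (twoLineSucc n₁ n₂) = uPlus q l₁ l₂ (n₁ + (n₂ + 1)) (n₁ + 1) *
      (rowSymm q l₁ l₂ (n₁ + (n₂ + 1)) 0 n₁ * rowSymm q l₁ l₂ (n₁ + (n₂ + 1)) (n₁ + 1) n₂) := by
  have h : ∀ a, rowSymm q l₁ l₂ (n₁ + (n₂ + 1)) a 1 = 1 := fun a => by simp [rowSymm, desc]
  rw [murphyElt, rows₁_twoLineSucc, rows₂]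
  simp only [twoLineSucc]
  split_ifs with hn
  · subst hn
    rw [List.singleton_append, youngSymm, youngSymm_sort, h, rowSymm]
  · rw [List.cons_append, List.singleton_append, youngSymm, youngSymm, youngSymm_sort, h, one_mul,
      zero_add]

/-- The class of `m_b` in the Specht module. -/
noncomputable def spechtGen (q l₁ l₂ : k) (b : Bipartition n) : SpechtModule q l₁ l₂ b :=
  Submodule.Quotient.mk ⟨murphyElt q l₁ l₂ b, Submodule.mem_span_singleton_self _⟩

theorem exists_smul_spechtGen (b : Bipartition n) (s : SpechtModule q l₁ l₂ b) :
    ∃ h : HeckeB q l₁ l₂ n, h • spechtGen q l₁ l₂ b = s := by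
  obtain ⟨⟨x, hx⟩, rfl⟩ := Submodule.Quotient.mk_surjective _ s
  obtain ⟨h, rfl⟩ := Submodule.mem_span_singleton.mp hx
  exact ⟨h, rfl⟩

theorem smul_spechtGen_eq (b : Bipartition n) {h : HeckeB q l₁ l₂ n} {c : k}
    (hc : (h - algebraMap k _ c) * murphyElt q l₁ l₂ b ∈ cellIdeal q l₁ l₂ b) :
    h • spechtGen q l₁ l₂ b = c • spechtGen q l₁ l₂ b := by
  have h₀ : (h - algebraMap k _ c) • spechtGen q l₁ l₂ b = 0 := by
    rw [spechtGen, ← Submodule.Quotient.mk_smul, Submodule.Quotient.mk_eq_zero]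
    exact TwoSidedIdeal.mem_asIdeal.mpr hc
  rwa [sub_smul, sub_eq_zero, algebraMap_smul] at h₀

theorem isTwoLine_spechtGen (hq : q ≠ 0) (n₁ n₂ : ℕ) :
    IsTwoLine q l₁ l₂ (n₁ + n₂) n₁ (spechtGen q l₁ l₂ (twoLine n₁ n₂)) where
  twoRow i hi hn ha := by
    refine smul_spechtGen_eq _ ?_
    have hu := (gen_comm_uPlus (q := q) (l₁ := l₁) (l₂ := l₂) hq (by omega) hn
      (by omega : i ≠ n₁)).eq
    have h : gen q l₁ l₂ (n₁ + n₂) i *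
        (rowSymm q l₁ l₂ (n₁ + n₂) 0 n₁ * rowSymm q l₁ l₂ (n₁ + n₂) n₁ n₂)
        = q • (rowSymm q l₁ l₂ (n₁ + n₂) 0 n₁ * rowSymm q l₁ l₂ (n₁ + n₂) n₁ n₂) := by
      rcases Nat.lt_or_ge i n₁ with h | h
      · rw [← mul_assoc, gen_mul_rowSymm hq (by omega) hi (by omega), smul_mul_assoc]
      · have h' : Commute (gen q l₁ l₂ (n₁ + n₂) i) (rowSymm q l₁ l₂ (n₁ + n₂) 0 n₁) :=
          commute_rowSymm fun j _ _ => (gen_comm (by omega)).symm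
        rw [← mul_assoc, h'.eq, mul_assoc, gen_mul_rowSymm hq le_rfl (by omega) hn, mul_smul_comm]
    rw [murphyElt_twoLine, sub_mul, ← mul_assoc, hu, mul_assoc, h, mul_smul_comm,
      ← Algebra.smul_def, sub_self]
    exact zero_mem _
  gen_zero ha := by
    refine smul_spechtGen_eq _ ?_
    rw [murphyElt_twoLine, sub_mul, ← mul_assoc, gen_zero_mul_uPlus (by omega) ha,
      smul_mul_assoc, ← Algebra.smul_def, sub_self]
    exact zero_mem _
  jm hn := by
    obtain ⟨n₂, rfl⟩ := Nat.exists_eq_add_of_le' (show 1 ≤ n₂ by omega)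
    refine smul_spechtGen_eq _ ?_
    obtain ⟨y, hy⟩ := exists_rowSymm_succ_eq (q := q) (l₁ := l₁) (l₂ := l₂) (a := n₁) hq le_rfl
    have hu : Commute (jm q l₁ l₂ (n₁ + (n₂ + 1)) (n₁ + 1) - algebraMap k _ l₂)
        (uPlus q l₁ l₂ (n₁ + (n₂ + 1)) n₁) :=
      (commute_uPlus fun i h₁ h₂ => (jm_comm_jm_of_lt h₁ (by omega)).symm).sub_left
        (Algebra.commutes _ _)
    have h : (jm q l₁ l₂ (n₁ + (n₂ + 1)) (n₁ + 1) - algebraMap k _ l₂)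
        * murphyElt q l₁ l₂ (twoLine n₁ (n₂ + 1))
        = murphyElt q l₁ l₂ (twoLineSucc n₁ n₂) * y := by
      rw [murphyElt_twoLine, murphyElt_twoLineSucc, ← mul_assoc, hu.eq, ← uPlus_succ, hy]
      simp only [mul_assoc]
    rw [h]
    exact TwoSidedIdeal.mul_mem_right _ _ _
      (TwoSidedIdeal.subset_span ⟨_, twoLineSucc_strictlyDominates _ _, rfl⟩)

theorem mem_orb_spechtGen (hq : q ≠ 0) {n₁ n₂ : ℕ} (hn : 1 ≤ n₁ + n₂)
    (s : SpechtModule q l₁ l₂ (twoLine n₁ n₂)) :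
    s ∈ orb q l₁ l₂ (n₁ + n₂) 1 (spechtGen q l₁ l₂ (twoLine n₁ n₂)) := by
  obtain ⟨h, rfl⟩ := exists_smul_spechtGen _ s
  exact (isTwoLine_spechtGen hq n₁ n₂).smul_mem_orb hq hn (by omega) h

theorem jm_mul_jm_sub_smul_specht (hq : q ≠ 0) (hq4 : q ^ 4 ≠ 1) {n₁ n₂ : ℕ}
    (hn : 2 ≤ n₁ + n₂) (s : SpechtModule q l₁ l₂ (twoLine n₁ n₂)) :
    ((jm q l₁ l₂ (n₁ + n₂) 1 * jm q l₁ l₂ (n₁ + n₂) 2 - algebraMap k _ (l₁ * l₂))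
      * (gen q l₁ l₂ (n₁ + n₂) 1 - algebraMap k _ q)) • s = 0 :=
  (isTwoLine_spechtGen hq n₁ n₂).jm_mul_jm_sub_smul hq hq4 hn (by omega)
    (mem_orb_spechtGen hq (by omega) s)

theorem tl_smul_specht (hq : q ≠ 0) (hq4 : q ^ 4 ≠ 1) {n₁ n₂ i : ℕ} (hi : 1 ≤ i)
    (hn : i + 1 < n₁ + n₂) (s : SpechtModule q l₁ l₂ (twoLine n₁ n₂)) :
    tl q l₁ l₂ (n₁ + n₂) i (i + 1) • s = 0 :=
  tl_smul_eq_zero hq (fun h x => (isTwoLine_spechtGen hq n₁ n₂).twoRow.tl_smul hq hq4 h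
    (by omega) (mem_orb_spechtGen hq (by omega) x)) hi hn s

end SpechtGen

/-! ### The blob algebra as a quotient of the Hecke algebra -/

section Gauss

variable {k : Type*} [Field k] {q : k}

theorem sub_inv_ne_zero (hq : q ≠ 0) (hq4 : q ^ 4 ≠ 1) : q - q⁻¹ ≠ 0 := by
  intro h
  field_simp at h
  exact hq4 (by linear_combination (q ^ 2 + 1) * h)

theorem gaussInt_two (hq : q ≠ 0) (hq4 : q ^ 4 ≠ 1) : gaussInt q 2 = q + q⁻¹ := by
  rw [gaussInt, div_eq_iff (sub_inv_ne_zero hq hq4), zpow_neg]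
  norm_cast
  field_simp
  ring

theorem gaussInt_sub_one (hq : q ≠ 0) (m : ℤ) : gaussInt q (m - 1)
    = q⁻¹ * (q ^ m / (q - q⁻¹)) - q * (q ^ (-m) / (q - q⁻¹)) := by
  rw [gaussInt, zpow_sub_one₀ hq, show -(m - 1) = -m + 1 by ring, zpow_add_one₀ hq]
  ring

end Gauss

section Relations

variable {k : Type*} [Field k] {A : Type*} [Ring A] [Algebra k A] {q l₁ l₂ : k}

theorem braid_add_algebraMap (hq : q ≠ 0) {u v : A} (hu : u * u = -((q + q⁻¹) • u))
    (hv : v * v = -((q + q⁻¹) • v)) (huv : u * v * u = u) (hvu : v * u * v = v) :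
    (u + algebraMap k A q) * (v + algebraMap k A q) * (u + algebraMap k A q)
      = (v + algebraMap k A q) * (u + algebraMap k A q) * (v + algebraMap k A q) := by
  simp only [Algebra.algebraMap_eq_smul_one, mul_add, add_mul, smul_mul_assoc, mul_smul_comm,
    one_mul, mul_one, smul_add, hu, hv, huv, hvu]
  match_scalars <;> field_simp <;> ring

theorem quad_add_algebraMap {u : A} {c d : k} (hu : u * u = -((c - d) • u)) :
    (u + algebraMap k A c - algebraMap k A c) * (u + algebraMap k A c - algebraMap k A d) = 0 := by
  simp only [Algebra.algebraMap_eq_smul_one, mul_add, mul_sub, add_sub_cancel_right,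
    mul_smul_comm, mul_one, hu]
  module

theorem sq_sub_algebraMap {x : A} {c d : k}
    (hx : (x - algebraMap k A c) * (x - algebraMap k A d) = 0) :
    (x - algebraMap k A c) * (x - algebraMap k A c) = -((c - d) • (x - algebraMap k A c)) := by
  rw [← sub_eq_zero, ← hx]
  simp only [Algebra.algebraMap_eq_smul_one, mul_sub, mul_smul_comm, mul_one]
  module

theorem braid_zero_add_algebraMap (hq : q ≠ 0) {x u : A} (hu : u * u = -((q + q⁻¹) • u))
    (hx : x * x = -((l₁ - l₂) • x)) (h : u * x * u = (q⁻¹ * l₁ - q * l₂) • u) :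
    (u + algebraMap k A q) * (x + algebraMap k A l₁) * (u + algebraMap k A q)
        * (x + algebraMap k A l₁)
      = (x + algebraMap k A l₁) * (u + algebraMap k A q) * (x + algebraMap k A l₁)
        * (u + algebraMap k A q) := by
  rw [mul_assoc] at h
  simp only [Algebra.algebraMap_eq_smul_one, mul_add, add_mul, smul_mul_assoc, mul_smul_comm,
    one_mul, mul_one, smul_add, mul_assoc, hu, hx, h, smul_neg, mul_neg, neg_mul]
  match_scalars <;> field_simp <;> ring

theorem jm_mul_jm_sub_eq (hq : q ≠ 0) {x g : A} (hg : g * g = 1 + (q - q⁻¹) • g)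
    (hx : x * x = (l₁ + l₂) • x - (l₁ * l₂) • (1 : A)) :
    (x * (g * x * g) - algebraMap k A (l₁ * l₂)) * (g - algebraMap k A q)
      = (-q⁻¹) • (x * ((g - algebraMap k A q) * (x - algebraMap k A l₁) * (g - algebraMap k A q)
        - (q⁻¹ * l₁ - q * l₂) • (g - algebraMap k A q))) := by
  have hx' : ∀ z, x * (x * z) = (l₁ + l₂) • (x * z) - (l₁ * l₂) • z := fun z => by
    rw [← mul_assoc, hx, sub_mul, smul_mul_assoc, smul_mul_assoc, one_mul]
  simp only [Algebra.algebraMap_eq_smul_one, mul_add, mul_sub, sub_mul, smul_mul_assoc,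
    mul_smul_comm, one_mul, mul_one, smul_add, smul_sub, mul_assoc, hg, hx, hx']
  match_scalars <;> field_simp <;> ring

end Relations

namespace BlobAlgebra

variable {k : Type*} [Field k] {q : k} {m : ℤ} {n : ℕ}

local notation "υ" => U q m n

theorem U_of_lt {i : ℕ} (h : i < n) :
    υ i = RingQuot.mkAlgHom k (BlobRel q m n) (FreeAlgebra.ι k ⟨i, h⟩) := by
  simp [U, h]

theorem U_tl {i j : ℕ} (hi : 1 ≤ i) (hj : 1 ≤ j) (hin : i < n) (hjn : j < n)
    (h : j = i + 1 ∨ i = j + 1) : υ i * υ j * υ i = υ i := by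
  rw [U_of_lt hin, U_of_lt hjn]
  simpa using RingQuot.mkAlgHom_rel k
    (BlobRel.tl (q := q) (m := m) (n := n) ⟨i, hin⟩ ⟨j, hjn⟩ hi hj h)

theorem U_sq {i : ℕ} (hi : 1 ≤ i) (hin : i < n) : υ i * υ i = -(gaussInt q 2 • υ i) := by
  rw [U_of_lt hin]
  simpa using RingQuot.mkAlgHom_rel k (BlobRel.sq (q := q) (m := m) (n := n) ⟨i, hin⟩ hi)

theorem U_zero_sq (hn : 0 < n) : υ 0 * υ 0 = -(gaussInt q m • υ 0) := by
  rw [U_of_lt hn]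
  simpa using RingQuot.mkAlgHom_rel k (BlobRel.sqZero (q := q) (m := m) (n := n) ⟨0, hn⟩ rfl)

theorem U_blob (hn : 1 < n) : υ 1 * υ 0 * υ 1 = gaussInt q (m - 1) • υ 1 := by
  rw [U_of_lt hn, U_of_lt (by omega)]
  simpa using RingQuot.mkAlgHom_rel k
    (BlobRel.blob (q := q) (m := m) (n := n) ⟨0, by omega⟩ ⟨1, hn⟩ rfl rfl)

theorem U_comm {i j : ℕ} (h : i + 1 < j) (hj : j < n) : Commute (υ i) (υ j) := by
  rw [U_of_lt hj, U_of_lt (by omega : i < n)]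
  simpa [Commute, SemiconjBy] using RingQuot.mkAlgHom_rel k
    (BlobRel.comm (q := q) (m := m) (n := n) ⟨i, by omega⟩ ⟨j, hj⟩ h)

end BlobAlgebra

section Projection

/-- The eigenvalue that is subtracted from the generators of the Hecke algebra to obtain those of
the blob algebra. -/
def shift {k : Type*} (q l₁ : k) (i : ℕ) : k := if i = 0 then l₁ else q

theorem shift_zero {k : Type*} {q l₁ : k} : shift q l₁ 0 = l₁ := rfl

theorem shift_of_pos {k : Type*} {q l₁ : k} {i : ℕ} (hi : 1 ≤ i) : shift q l₁ i = q := if_neg (by omega)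

open BlobAlgebra

variable {k : Type*} [Field k] {q l₁ l₂ : k} {m : ℤ} {n : ℕ}

theorem heckeRel_lift (hq : q ≠ 0) (hq4 : q ^ 4 ≠ 1) (hl₁ : l₁ = q ^ m / (q - q⁻¹))
    (hl₂ : l₂ = q ^ (-m) / (q - q⁻¹)) ⦃x y : FreeAlgebra k (Fin n)⦄
    (h : HeckeRel q l₁ l₂ n x y) :
    FreeAlgebra.lift k (fun i : Fin n => U q m n i + algebraMap k _ (shift q l₁ i)) x
      = FreeAlgebra.lift k (fun i : Fin n => U q m n i + algebraMap k _ (shift q l₁ i)) y := by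
  have h2 := gaussInt_two hq hq4
  have hm : gaussInt q m = l₁ - l₂ := by rw [hl₁, hl₂, gaussInt, sub_div]
  have hm1 : gaussInt q (m - 1) = q⁻¹ * l₁ - q * l₂ := by rw [hl₁, hl₂, gaussInt_sub_one hq]
  have hU : ∀ {i : ℕ}, 1 ≤ i → i < n → U q m n i * U q m n i = -((q + q⁻¹) • U q m n i) :=
    fun h₁ h₂ => h2 ▸ U_sq h₁ h₂
  cases h with
  | braid i j hi hj =>
    simp only [map_mul, FreeAlgebra.lift_ι_apply, shift_of_pos hi,
      shift_of_pos (by omega : 1 ≤ j.val)]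
    exact braid_add_algebraMap hq (hU hi i.2) (hU (by omega) j.2)
      (U_tl hi (by omega) i.2 j.2 (by omega)) (U_tl (by omega) hi j.2 i.2 (by omega))
  | comm i j hij =>
    simp only [map_mul, FreeAlgebra.lift_ι_apply]
    exact ((U_comm hij j.2).add_right (Algebra.commutes _ _).symm).add_left
      (Algebra.commutes _ _)
  | braidX i j hi hj =>
    simp only [map_mul, FreeAlgebra.lift_ι_apply, hi, hj, shift_zero, shift_of_pos le_rfl]
    exact braid_zero_add_algebraMap hq (hU le_rfl (by omega)) (hm ▸ U_zero_sq (by omega))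
      (hm1 ▸ U_blob (by omega))
  | quad i hi =>
    simp only [map_mul, map_add, map_sub, AlgHom.commutes, FreeAlgebra.lift_ι_apply,
      shift_of_pos hi, map_zero]
    have h := quad_add_algebraMap (c := q) (d := -q⁻¹) (u := U q m n i)
      (by rw [sub_neg_eq_add]; exact hU hi i.2)
    rwa [map_neg, sub_neg_eq_add] at h
  | quadX i hi =>
    simp only [map_mul, map_sub, AlgHom.commutes, FreeAlgebra.lift_ι_apply, hi, shift_zero,
      map_zero]
    exact quad_add_algebraMap (hm ▸ U_zero_sq (by omega))

theorem exists_projection (hq : q ≠ 0) (hq4 : q ^ 4 ≠ 1) (hl₁ : l₁ = q ^ m / (q - q⁻¹))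
    (hl₂ : l₂ = q ^ (-m) / (q - q⁻¹)) :
    ∃ π : HeckeB q l₁ l₂ n →ₐ[k] BlobAlgebra q m n, Function.Surjective π ∧
      ∀ i, i < n → π (gen q l₁ l₂ n i - algebraMap k _ (shift q l₁ i)) = U q m n i := by
  let π : HeckeB q l₁ l₂ n →ₐ[k] BlobAlgebra q m n :=
    RingQuot.liftAlgHom k ⟨_, heckeRel_lift hq hq4 hl₁ hl₂⟩
  have hπ : ∀ i, i < n → π (gen q l₁ l₂ n i - algebraMap k _ (shift q l₁ i)) = U q m n i := by
    intro i hi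
    rw [gen_of_lt hi, map_sub, AlgHom.commutes, RingQuot.liftAlgHom_mkAlgHom_apply,
      FreeAlgebra.lift_ι_apply, add_sub_cancel_right]
  refine ⟨π, fun x => ?_, hπ⟩
  change x ∈ π.range
  obtain ⟨p, rfl⟩ := RingQuot.mkAlgHom_surjective k (BlobRel q m n) x
  induction p using FreeAlgebra.induction with
  | grade0 r => rw [AlgHom.commutes]; exact algebraMap_mem _ r
  | grade1 i => exact ⟨_, (hπ i i.2).trans (U_of_lt i.2)⟩
  | mul a b ha hb => rw [map_mul]; exact mul_mem ha hb
  | add a b ha hb => rw [map_add]; exact add_mem ha hb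

end Projection

section Action

variable {k : Type*} [Field k] {q l₁ l₂ : k} {m : ℤ} {n₁ n₂ : ℕ}

theorem blob_smul_eq_zero {n : ℕ} {M : Type*} [AddCommGroup M] [Module k M]
    [Module (HeckeB q l₁ l₂ n) M] [IsScalarTower k (HeckeB q l₁ l₂ n) M] (hq : q ≠ 0)
    (h₁ : l₁ ≠ 0) (h₂ : l₂ ≠ 0) (hn : 2 ≤ n) {s : M}
    (hE : ((jm q l₁ l₂ n 1 * jm q l₁ l₂ n 2 - algebraMap k _ (l₁ * l₂))
      * (gen q l₁ l₂ n 1 - algebraMap k _ q)) • s = 0) :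
    ((gen q l₁ l₂ n 1 - algebraMap k _ q) * (gen q l₁ l₂ n 0 - algebraMap k _ l₁)
      * (gen q l₁ l₂ n 1 - algebraMap k _ q)
      - (q⁻¹ * l₁ - q * l₂) • (gen q l₁ l₂ n 1 - algebraMap k _ q)) • s = 0 := by
  have hx := gen_zero_mul_gen_zero (q := q) (l₁ := l₁) (l₂ := l₂) (show 0 < n by omega)
  have h := jm_mul_jm_sub_eq hq
    (gen_mul_gen (q := q) (l₁ := l₁) (l₂ := l₂) (n := n) hq le_rfl (by omega)) hx
  rw [show jm q l₁ l₂ n 1 = gen q l₁ l₂ n 0 from rfl, show jm q l₁ l₂ n 2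
    = gen q l₁ l₂ n 1 * gen q l₁ l₂ n 0 * gen q l₁ l₂ n 1 from rfl, h, smul_assoc, mul_smul] at hE
  have h₀ := (smul_eq_zero.mp hE).resolve_left (neg_ne_zero.mpr (inv_ne_zero hq))
  have h₃ := congrArg (gen q l₁ l₂ n 0 • ·) h₀
  simp only [smul_zero] at h₃
  rw [smul_smul, hx, sub_smul, smul_assoc, h₀, smul_zero, zero_sub, neg_eq_zero, smul_assoc,
    one_smul] at h₃
  exact (smul_eq_zero.mp h₃).resolve_left (mul_ne_zero h₁ h₂)

theorem gen_sub_comm_gen_sub {n i j : ℕ} (h : i + 1 < j) (c d : k) :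
    Commute (gen q l₁ l₂ n i - algebraMap k _ c) (gen q l₁ l₂ n j - algebraMap k _ d) :=
  ((gen_comm h).sub_right (Algebra.commutes _ _).symm).sub_left (Algebra.commutes _ _)

theorem gen_sub_mul_gen_sub (hq : q ≠ 0) {n i : ℕ} (hi : 1 ≤ i) (hn : i < n) :
    (gen q l₁ l₂ n i - algebraMap k _ q) * (gen q l₁ l₂ n i - algebraMap k _ q)
      = -((q + q⁻¹) • (gen q l₁ l₂ n i - algebraMap k _ q)) := by
  rw [mul_sub, gen_sub_mul_gen hq hi hn, ← Algebra.commutes, ← Algebra.smul_def]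
  module

theorem blobRel_lift (hq : q ≠ 0) (hq4 : q ^ 4 ≠ 1) (h₁ : l₁ ≠ 0) (h₂ : l₂ ≠ 0)
    (hl₁ : l₁ = q ^ m / (q - q⁻¹)) (hl₂ : l₂ = q ^ (-m) / (q - q⁻¹))
    ⦃x y : FreeAlgebra k (Fin (n₁ + n₂))⦄ (h : BlobRel q m (n₁ + n₂) x y) :
    FreeAlgebra.lift k (fun i : Fin (n₁ + n₂) =>
        Algebra.lsmul k k (SpechtModule q l₁ l₂ (twoLine n₁ n₂))
          (gen q l₁ l₂ (n₁ + n₂) i - algebraMap k _ (shift q l₁ i))) x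
      = FreeAlgebra.lift k (fun i : Fin (n₁ + n₂) =>
        Algebra.lsmul k k (SpechtModule q l₁ l₂ (twoLine n₁ n₂))
          (gen q l₁ l₂ (n₁ + n₂) i - algebraMap k _ (shift q l₁ i))) y := by
  have h2 := gaussInt_two hq hq4
  have hm : gaussInt q m = l₁ - l₂ := by rw [hl₁, hl₂, gaussInt, sub_div]
  have hm1 : gaussInt q (m - 1) = q⁻¹ * l₁ - q * l₂ := by rw [hl₁, hl₂, gaussInt_sub_one hq]
  have key : ∀ {a b : HeckeB q l₁ l₂ (n₁ + n₂)},
      (∀ s : SpechtModule q l₁ l₂ (twoLine n₁ n₂), (a - b) • s = 0) →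
      Algebra.lsmul k k (SpechtModule q l₁ l₂ (twoLine n₁ n₂)) a = Algebra.lsmul k k _ b :=
    fun h => LinearMap.ext fun s => sub_eq_zero.mp ((sub_smul _ _ s).symm.trans (h s))
  cases h with
  | tl i j hi hj hij =>
    simp only [map_mul, FreeAlgebra.lift_ι_apply, shift_of_pos hi, shift_of_pos hj]
    rw [← map_mul, ← map_mul]
    refine key fun s => ?_
    have hin := i.2
    have hjn := j.2
    rcases hij with h | h
    · rw [h]
      exact tl_smul_specht hq hq4 hi (by omega) s
    · rw [h]
      have := tl_smul_specht (l₁ := l₁) (l₂ := l₂) hq hq4 hj (by omega) s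
      rwa [tl_comm hq hj (by omega)] at this
  | sq i hi =>
    simp only [map_mul, map_neg, map_smul, FreeAlgebra.lift_ι_apply, shift_of_pos hi]
    rw [← map_mul, ← map_smul, ← map_neg, h2]
    exact congrArg _ (gen_sub_mul_gen_sub hq hi i.2)
  | sqZero i hi =>
    simp only [map_mul, map_neg, map_smul, FreeAlgebra.lift_ι_apply, hi, shift_zero]
    rw [← map_mul, ← map_smul, ← map_neg, hm]
    exact congrArg _ (sq_sub_algebraMap (gen_zero_quad (by omega)))
  | blob i j hi hj =>
    simp only [map_mul, map_smul, FreeAlgebra.lift_ι_apply, hi, hj, shift_zero,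
      shift_of_pos le_rfl]
    rw [← map_mul, ← map_mul, ← map_smul, hm1]
    exact key fun s => blob_smul_eq_zero hq h₁ h₂ (by omega)
      (jm_mul_jm_sub_smul_specht hq hq4 (by omega) s)
  | comm i j hij =>
    simp only [map_mul, FreeAlgebra.lift_ι_apply]
    rw [← map_mul, ← map_mul]
    exact congrArg _ (gen_sub_comm_gen_sub hij _ _).eq

theorem exists_blob_action (hq : q ≠ 0) (hq4 : q ^ 4 ≠ 1) (h₁ : l₁ ≠ 0) (h₂ : l₂ ≠ 0)
    (hl₁ : l₁ = q ^ m / (q - q⁻¹)) (hl₂ : l₂ = q ^ (-m) / (q - q⁻¹))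
    {π : HeckeB q l₁ l₂ (n₁ + n₂) →ₐ[k] BlobAlgebra q m (n₁ + n₂)}
    (hπ : ∀ i, i < n₁ + n₂ → π (gen q l₁ l₂ (n₁ + n₂) i - algebraMap k _ (shift q l₁ i))
      = BlobAlgebra.U q m (n₁ + n₂) i) :
    ∃ ρ : BlobAlgebra q m (n₁ + n₂) →ₐ[k]
        Module.End k (SpechtModule q l₁ l₂ (twoLine n₁ n₂)),
      ∀ (h : HeckeB q l₁ l₂ (n₁ + n₂)) (s : SpechtModule q l₁ l₂ (twoLine n₁ n₂)),
        ρ (π h) s = h • s := by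
  let ρ : BlobAlgebra q m (n₁ + n₂) →ₐ[k]
      Module.End k (SpechtModule q l₁ l₂ (twoLine n₁ n₂)) :=
    RingQuot.liftAlgHom k ⟨_, blobRel_lift hq hq4 h₁ h₂ hl₁ hl₂⟩
  have hρ : ρ.comp π = Algebra.lsmul k k (SpechtModule q l₁ l₂ (twoLine n₁ n₂)) := by
    refine RingQuot.ringQuot_ext' _ _ _ (FreeAlgebra.hom_ext (funext fun i => ?_))
    have h := hπ i i.2
    have h' : ρ (BlobAlgebra.U q m (n₁ + n₂) i) = Algebra.lsmul k k _
        (gen q l₁ l₂ (n₁ + n₂) i - algebraMap k _ (shift q l₁ i)) := by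
      rw [BlobAlgebra.U_of_lt i.2, RingQuot.liftAlgHom_mkAlgHom_apply, FreeAlgebra.lift_ι_apply]
    rw [← h, map_sub, map_sub, map_sub, AlgHom.commutes, AlgHom.commutes, AlgHom.commutes,
      sub_left_inj, gen_of_lt i.2] at h'
    exact h'
  exact ⟨ρ, fun h s => congrArg (· s) (DFunLike.congr_fun hρ h)⟩

end Action

end BlobSpecht

theorem mainTheorem6 {k : Type*} [Field k] (q l₁ l₂ : k)
    (hq : q ≠ 0) (hl₁ : l₁ ≠ 0) (hl₂ : l₂ ≠ 0)
    (hq4 : q ^ 4 ≠ 1) (hl : l₁ ≠ l₂) (hl' : l₁ ≠ q ^ 2 * l₂)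
    (n₁ n₂ : ℕ) (hn : 1 ≤ n₁ + n₂) :
    -- `(X_1 X_2 - l₁ l₂) (g_1 - q)` kills the Specht module
    (2 ≤ n₁ + n₂ →
      ∀ s : BlobSpecht.SpechtModule q l₁ l₂ (BlobSpecht.Bipartition.twoLine n₁ n₂),
        ((BlobSpecht.HeckeB.jm q l₁ l₂ (n₁ + n₂) 1 * BlobSpecht.HeckeB.jm q l₁ l₂ (n₁ + n₂) 2
            - algebraMap k (BlobSpecht.HeckeB q l₁ l₂ (n₁ + n₂)) (l₁ * l₂))
          * (BlobSpecht.HeckeB.gen q l₁ l₂ (n₁ + n₂) 1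
            - algebraMap k (BlobSpecht.HeckeB q l₁ l₂ (n₁ + n₂)) q)) • s = 0) ∧
    -- the action on the Specht module factors through the surjection onto the blob algebra
    ∀ m : ℤ, l₁ = q ^ m / (q - q⁻¹) → l₂ = q ^ (-m) / (q - q⁻¹) →
      ∃ π : BlobSpecht.HeckeB q l₁ l₂ (n₁ + n₂) →ₐ[k] BlobSpecht.BlobAlgebra q m (n₁ + n₂),
        Function.Surjective π ∧
        π (BlobSpecht.HeckeB.gen q l₁ l₂ (n₁ + n₂) 0 - algebraMap k _ l₁)
          = BlobSpecht.BlobAlgebra.U q m (n₁ + n₂) 0 ∧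
        (∀ i : ℕ, 1 ≤ i → i < n₁ + n₂ →
          π (BlobSpecht.HeckeB.gen q l₁ l₂ (n₁ + n₂) i - algebraMap k _ q)
            = BlobSpecht.BlobAlgebra.U q m (n₁ + n₂) i) ∧
        ∃! ρ : BlobSpecht.BlobAlgebra q m (n₁ + n₂) →ₐ[k]
            Module.End k
              (BlobSpecht.SpechtModule q l₁ l₂ (BlobSpecht.Bipartition.twoLine n₁ n₂)),
          ∀ (h : BlobSpecht.HeckeB q l₁ l₂ (n₁ + n₂))
            (s : BlobSpecht.SpechtModule q l₁ l₂ (BlobSpecht.Bipartition.twoLine n₁ n₂)),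
            ρ (π h) s = h • s := by

  refine ⟨fun hn2 s => BlobSpecht.jm_mul_jm_sub_smul_specht hq hq4 hn2 s, fun m h₁ h₂ => ?_⟩
  obtain ⟨π, hπ, hU⟩ := BlobSpecht.exists_projection (n := n₁ + n₂) hq hq4 h₁ h₂
  obtain ⟨ρ, hρ⟩ := BlobSpecht.exists_blob_action hq hq4 hl₁ hl₂ h₁ h₂ hU
  refine ⟨π, hπ, hU 0 (by omega), fun i hi hin => ?_, ρ, hρ, fun ρ' hρ' => ?_⟩
  · have h := hU i hin
    rwa [BlobSpecht.shift_of_pos hi] at h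
  · refine AlgHom.ext fun x => LinearMap.ext fun s => ?_
    obtain ⟨h, rfl⟩ := hπ x
    rw [hρ, hρ']
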